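/- Let $\mathcal N=\mathbb N^{\mathbb N}$ be the Baire space. A represented space is a set $X$ with a partial onto map $\delta_X:\subseteq\mathcal N\to X$; if $\delta_X(p)=x$ then $p$ is a name of $x$. Its canonical topology is the final topology of $\delta_X$: $U\subseteq X$ is open iff $\delta_X^{-1}(U)$ is the trace on $\mathrm{dom}(\delta_X)$ of an open subset of $\mathcal N$. The space $\mathcal N$ is represented by the identity; a name of $(x,y)\in X\times Y$ is a pair (interleaving) of names of $x$ and $y$; the Sierpiński space $\mathbb S=\{\bot,\top\}$ is represented by $\delta_{\mathbb S}(0^{\mathbb N})=\bot$ and $\delta_{\mathbb S}(p)=\top$ for $p\ne 0^{\mathbb N}$. A name of a function $f:X\to Y$ is a (coded) list of pairs $(u,v)$ of finite sequences describing a realizer $F$ of $f$, where a realizer maps any name of any $x$ to a name of $f(x)$: for every $q\in\mathrm{dom}(\delta_X)$, if $u$ is a prefix of $q$ and $(u,v)$ is listed then $v$ is a prefix of $F(q)$, and for each prefix $v$ of $F(q)$ there is a prefix $u$ of $q$ such that $(u,v)$ is listed. The set $\mathcal O(X)$ of open subsets of $X$ is represented by letting the names of $U$ be the names of its characteristic function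 $X\to\mathbb S$. A set $B\subseteq\mathcal N$ is $\Sigma^0_2$ (lightface) if there are uniformly recursively enumerable sets $W_n$ of finite sequences such that $p\in B$ iff for some $n$ no prefix of $p$ is in $W_n$. A set $A\subseteq X$ is $\Sigma^0_2$ if $\delta_X^{-1}(A)=B\cap\mathrm{dom}(\delta_X)$ for some $\Sigma^0_2$ set $B\subseteq\mathcal N$. A function $f:X\to Y$ is $\Sigma^0_2$-measurable if $\{(x,U):f(x)\in U\}$ is a $\Sigma^0_2$ subset of $X\times\mathcal O(Y)$ (preimages of open sets are $\Sigma^0_2$, effectively). A subset of a represented space is Borel if it belongs to the smallest class that contains the open sets of the canonical topology and is closed under complements and countable unions. Let $E=\{(f,O)\in\mathcal N\times\mathcal O(\mathcal N): f\in O\}$. For $n,k\in\mathbb N$ let $c_n$ be the constant sequence $n$, and let $c_{n,k}$ have value $n+1$ at $k$ and $n$ elsewhere. For $O\in\mathcal O(\mathcal N)$ let $r_1(O)=f\in\mathcal N$, where $f(n)=0$ if $c_n\notin O$, and $f(n)=\max\{k\ge1: c_{n,k}\notin O\}$ (with $\max\emptyset=0$; the set is finite) if $c_n\in O$. For $i\in\{0,1\}$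 let $O_i=\{g\in\mathcal N: (2g(0)+i,g(1),g(2),\dots)\in O\}$, so that $O\mapsto(O_0,O_1)$ identifies $\mathcal O(\mathcal N)$ with $\mathcal O(\mathcal N)\times\mathcal O(\mathcal N)$. Let $r:\mathcal O(\mathcal N)\to\mathcal N\times\mathcal O(\mathcal N)$, $r(O)=(r_1(O_0),O_1)$. **Theorem.** The canonical topology of $\mathcal O(\mathcal N)$ is the Scott topology (for inclusion). The map $r$ is $\Sigma^0_2$-measurable, and there is a map $s:\mathcal N\times\mathcal O(\mathcal N)\to\mathcal O(\mathcal N)$ with $r\circ s=\mathrm{id}$ that is continuous with respect to the product topology on $\mathcal N\times\mathcal O(\mathcal N)$. The set $A=r^{-1}(E)$ is a $\Sigma^0_2$ subset of $\mathcal O(\mathcal N)$ that is not Borel. In particular, $\mathcal O(\mathcal N)$ has a $\Sigma^0_2$ subset that is not Borel. -/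

import Mathlib

open scoped Topology MeasureTheory

/-- The Baire space, with the product topology. -/
abbrev Baire : Type := ℕ → ℕ

/-- The initial segment `p 0, …, p (k - 1)`. -/
def initialSegment (p : Baire) (k : ℕ) : List ℕ := (List.range k).map p

/-- The finite sequence `u` is a prefix of `p`. -/
def IsPrefixOf (u : List ℕ) (p : Baire) : Prop := initialSegment p u.length = u

/-- A represented space: a partial onto map from the Baire space to `X`, given by its graph;
`IsName p x` says that the map is defined at `p` with value `x`. -/
class RepresentedSpace (X : Type) where
  IsName : Baire → X → Prop
  unique : ∀ {p : Baire} {x y : X}, IsName p x → IsName p y → x = y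
  onto : ∀ x : X, ∃ p : Baire, IsName p x

open RepresentedSpace (IsName)

/-- The canonical topology of a represented space, i.e. the final topology of its representation:
`U` is open iff its preimage is the trace of an open set on the domain of the representation. -/
@[reducible]
def repTopology (X : Type) [RepresentedSpace X] : TopologicalSpace X where
  IsOpen U := ∃ V : Set Baire, IsOpen V ∧ ∀ p x, IsName p x → (x ∈ U ↔ p ∈ V)
  isOpen_univ := ⟨Set.univ, isOpen_univ, by simp⟩
  isOpen_inter := by
    rintro U U' ⟨V, hV, h⟩ ⟨V', hV', h'⟩
    exact ⟨V ∩ V', hV.inter hV', fun p x hp => and_congr (h p x hp) (h' p x hp)⟩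
  isOpen_sUnion := by
    intro 𝒰 h
    choose V hV hUV using h
    refine ⟨⋃ U, ⋃ hU : U ∈ 𝒰, V U hU, isOpen_iUnion fun U => isOpen_iUnion fun hU => hV U hU, ?_⟩
    intro p x hp
    simp only [Set.mem_sUnion, Set.mem_iUnion]
    exact ⟨fun ⟨U, hU, hx⟩ => ⟨U, hU, (hUV U hU p x hp).1 hx⟩,
      fun ⟨U, hU, hx⟩ => ⟨U, hU, (hUV U hU p x hp).2 hx⟩⟩

/-- The Baire space represented by the identity. -/
instance Baire.representedSpace : RepresentedSpace Baire where
  IsName p x := p = x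
  unique h h' := h.symm.trans h'
  onto x := ⟨x, rfl⟩

theorem repTopology_baire : repTopology Baire = Pi.topologicalSpace := by
  refine TopologicalSpace.ext_iff.2 fun U => ⟨?_, fun hU => ⟨U, hU, ?_⟩⟩
  · rintro ⟨V, hV, h⟩
    have : U = V := Set.ext fun x => h x x rfl
    exact this ▸ hV
  · rintro p x rfl
    rfl

/-- The product of represented spaces: a name of `(x, y)` is a pair of names, interleaved. -/
instance Prod.representedSpace {X Y : Type} [RepresentedSpace X] [RepresentedSpace Y] :
    RepresentedSpace (X × Y) where
  IsName p z := IsName (fun n => p (2 * n)) z.1 ∧ IsName (fun n => p (2 * n + 1)) z.2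
  unique h h' := Prod.ext (RepresentedSpace.unique h.1 h'.1) (RepresentedSpace.unique h.2 h'.2)
  onto := by
    rintro ⟨x, y⟩
    obtain ⟨p, hp⟩ := RepresentedSpace.onto x
    obtain ⟨q, hq⟩ := RepresentedSpace.onto y
    refine ⟨fun n => if n % 2 = 0 then p (n / 2) else q (n / 2), ?_, ?_⟩
    · convert hp using 2 with n
      simp
    · convert hq using 2 with n
      have h1 : (2 * n + 1) % 2 ≠ 0 := by omega
      have h2 : (2 * n + 1) / 2 = n := by omega
      simp [h2]

/-- The Sierpiński space on the truth values: the zero sequence is the only name of `⊥ = False`,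
all other sequences are names of `⊤ = True`. -/
instance sierpinskiRepresentedSpace : RepresentedSpace Prop where
  IsName p b := b ↔ ∃ n, p n ≠ 0
  unique h h' := propext (h.trans h'.symm)
  onto b := by
    by_cases hb : b
    · exact ⟨fun _ => 1, by simp [hb]⟩
    · exact ⟨fun _ => 0, by simp [hb]⟩

/-- The pair `(u, v)` of finite sequences occurs in the list of pairs encoded by `p`. -/
def ListsPair (p : Baire) (u v : List ℕ) : Prop := ∃ i, p i = Encodable.encode (u, v)

/-- `p` is a name of `f` in the function space `C(X, Y)`: the list of pairs encoded by `p` describes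
a realizer `F` of `f` (which is then continuous on the domain of the representation of `X`). -/
def IsMapName {X Y : Type} [RepresentedSpace X] [RepresentedSpace Y] (p : Baire) (f : X → Y) :
    Prop :=
  ∃ F : Baire → Baire, ∀ q x, IsName q x →
    IsName (F q) (f x) ∧
    (∀ u v, ListsPair p u v → IsPrefixOf u q → IsPrefixOf v (F q)) ∧
    (∀ v, IsPrefixOf v (F q) → ∃ u, IsPrefixOf u q ∧ ListsPair p u v)

theorem isPrefixOf_initialSegment (p : Baire) (k : ℕ) : IsPrefixOf (initialSegment p k) p := by
  simp [IsPrefixOf, initialSegment]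

theorem IsMapName.unique {X Y : Type} [RepresentedSpace X] [RepresentedSpace Y] {p : Baire}
    {f g : X → Y} (hf : IsMapName p f) (hg : IsMapName p g) : f = g := by
  obtain ⟨F, hF⟩ := hf
  obtain ⟨G, hG⟩ := hg
  funext x
  obtain ⟨q, hq⟩ := RepresentedSpace.onto x
  obtain ⟨hF1, -, hF3⟩ := hF q x hq
  obtain ⟨hG1, hG2, -⟩ := hG q x hq
  have h : F q = G q := by
    funext n
    obtain ⟨u, hu, hp⟩ := hF3 _ (isPrefixOf_initialSegment (F q) (n + 1))
    have h := hG2 _ _ hp hu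
    simp only [IsPrefixOf, initialSegment, List.length_map, List.length_range, List.map_inj_left,
      List.mem_range] at h
    exact (h n (Nat.lt_succ_self n)).symm
  exact RepresentedSpace.unique hF1 (h ▸ hG1)

/-- The open subsets of a represented space (open in its canonical topology). -/
structure OpenSubsets (X : Type) [RepresentedSpace X] : Type where
  carrier : Set X
  isOpen' : IsOpen[repTopology X] carrier

instance OpenSubsets.instSetLike (X : Type) [RepresentedSpace X] : SetLike (OpenSubsets X) X where
  coe := OpenSubsets.carrier
  coe_injective := by
    rintro ⟨U, hU⟩ ⟨V, hV⟩ h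
    congr

/-- Open sets are ordered by inclusion. -/
instance OpenSubsets.instPartialOrder (X : Type) [RepresentedSpace X] :
    PartialOrder (OpenSubsets X) := PartialOrder.ofSetLike (OpenSubsets X) X

open Classical in
theorem exists_isMapName {X : Type} [RepresentedSpace X] (U : OpenSubsets X) :
    ∃ p, IsMapName p (fun x => x ∈ U) := by
  obtain ⟨V, hV, hUV⟩ := U.2
  -- `F q k = 1` once the cylinder of the first `k` values of `q` lies in `V`
  let F : Baire → Baire := fun q k => if ∀ q', IsPrefixOf (initialSegment q k) q' → q' ∈ V
    then 1 else 0
  let ext : List ℕ → Baire := fun u n => u.getD n 0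
  have hseg : ∀ u q, IsPrefixOf u q → ∀ k ≤ u.length,
      initialSegment (ext u) k = initialSegment q k := by
    intro u q hu k hk
    refine List.map_inj_left.2 fun n hn => ?_
    have hn' : n < u.length := (List.mem_range.1 hn).trans_le hk
    have h : u[n]? = (initialSegment q u.length)[n]? := by rw [hu]
    simp only [ext, List.getD_eq_getElem?_getD, h]
    simp [initialSegment, hn']
  have hF : ∀ u q, IsPrefixOf u q →
      initialSegment (F (ext u)) u.length = initialSegment (F q) u.length := by
    intro u q hu
    refine List.map_inj_left.2 fun n hn => ?_
    simp only [F, hseg u q hu n (List.mem_range.1 hn).le]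
  refine ⟨fun i => Encodable.encode (Denumerable.ofNat (List ℕ) i,
    initialSegment (F (ext (Denumerable.ofNat (List ℕ) i)))
      (Denumerable.ofNat (List ℕ) i).length), F, fun q x hq => ⟨?_, ?_, ?_⟩⟩
  · change x ∈ U ↔ ∃ n, F q n ≠ 0
    have hxq : x ∈ U ↔ q ∈ V := hUV q x hq
    rw [hxq]
    constructor
    · intro hqV
      obtain ⟨I, W, hW, hWV⟩ := isOpen_pi_iff.1 hV q hqV
      obtain ⟨N, hN⟩ := I.exists_nat_subset_range
      refine ⟨N, ?_⟩
      have : ∀ q', IsPrefixOf (initialSegment q N) q' → q' ∈ V := by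
        intro q' h
        apply hWV
        intro i hi
        have hi' := Finset.mem_range.1 (hN hi)
        simp only [IsPrefixOf, initialSegment, List.length_map, List.length_range,
          List.map_inj_left, List.mem_range] at h
        rw [h i hi']
        exact (hW i hi).2
      simp only [F, if_pos this]
      exact one_ne_zero
    · rintro ⟨n, hn⟩
      by_contra hqV
      apply hn
      have : ¬ ∀ q', IsPrefixOf (initialSegment q n) q' → q' ∈ V :=
        fun h => hqV (h q (isPrefixOf_initialSegment q n))
      simp only [F, if_neg this]
  · rintro u v ⟨i, hi⟩ hu
    obtain ⟨rfl, rfl⟩ := Prod.mk.inj (Encodable.encode_injective hi)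
    rw [hF _ q hu]
    exact isPrefixOf_initialSegment _ _
  · intro v hv
    refine ⟨initialSegment q v.length, isPrefixOf_initialSegment _ _,
      Encodable.encode (initialSegment q v.length), ?_⟩
    have h := hF _ q (isPrefixOf_initialSegment q v.length)
    have hl : (initialSegment q v.length).length = v.length := by simp [initialSegment]
    simp only [Denumerable.ofNat_encode]
    rw [h, hl, hv]

/-- The represented space `O(X) = C(X, 𝕊)`: a name of an open set is a name of its characteristic
function. -/
instance OpenSubsets.representedSpace (X : Type) [RepresentedSpace X] :
    RepresentedSpace (OpenSubsets X) where
  IsName p U := IsMapName p (fun x => x ∈ U)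
  unique {p U V} hU hV := by
    have h := IsMapName.unique hU hV
    exact SetLike.ext fun x => iff_of_eq (congrFun h x)
  onto U := exists_isMapName U

/-- The (lightface) `Σ⁰₂` subsets of the Baire space: the unions of uniformly effectively closed
sequences of sets. The `n`-th closed set consists of the sequences having no prefix in the `n`-th
set of finite sequences, and these sets are recursively enumerable uniformly in `n`. -/
def IsSigma02Baire (B : Set Baire) : Prop :=
  ∃ W : ℕ → List ℕ → Prop, REPred (fun z : ℕ × List ℕ => W z.1 z.2) ∧
    ∀ p, p ∈ B ↔ ∃ n, ∀ u, IsPrefixOf u p → ¬ W n u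

/-- The `Σ⁰₂` subsets of a represented space: those whose preimage under the representation is the
trace of a `Σ⁰₂` subset of the Baire space on its domain. -/
def IsSigma02 {X : Type} [RepresentedSpace X] (A : Set X) : Prop :=
  ∃ B : Set Baire, IsSigma02Baire B ∧ ∀ p x, IsName p x → (x ∈ A ↔ p ∈ B)

/-- `f` is `Σ⁰₂`-measurable: preimages of open sets are `Σ⁰₂`, effectively in the open set, i.e. the
relation `f x ∈ U` is a `Σ⁰₂` subset of `X × O(Y)`. -/
def IsSigma02Measurable {X Y : Type} [RepresentedSpace X] [RepresentedSpace Y] (f : X → Y) : Prop :=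
  IsSigma02 {z : X × OpenSubsets Y | f z.1 ∈ z.2}

/-- A subset of a represented space is Borel if it lies in the σ-algebra generated by the sets that
are open in the canonical topology. -/
def IsBorelSubset {X : Type} [RepresentedSpace X] (A : Set X) : Prop :=
  MeasurableSet[@borel X (repTopology X)] A

/-- The sequence `c_{n,k}` with value `n + 1` at `k` and value `n` elsewhere. -/
def bumpSeq (n k : ℕ) : Baire := Function.update (fun _ => n) k (n + 1)

open Classical in
/-- The retraction `O ↦ f` with `f n = 0` if the constant sequence `n` is not in `O`, and
`f n = max {k ≥ 1 | c_{n,k} ∉ O}` (with `max ∅ = 0`) otherwise. In the latter case the set is finite,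
because `c_{n,k}` converges to the constant sequence `n` as `k → ∞`. -/
noncomputable def decodeSeq (O : OpenSubsets Baire) : Baire := fun n =>
  if (fun _ => n : Baire) ∈ O then sSup {k : ℕ | 1 ≤ k ∧ bumpSeq n k ∉ O} else 0

/-- For `i = 0, 1`, the homeomorphism from the Baire space onto the clopen set of the sequences
whose first value is congruent to `i` modulo `2`. -/
def intoHalf (i : ℕ) (g : Baire) : Baire := Function.update g 0 (2 * g 0 + i)

theorem continuous_intoHalf (i : ℕ) : Continuous (intoHalf i) := by
  unfold intoHalf
  have h : Continuous fun g : Baire => 2 * g 0 + i :=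
    (continuous_of_discreteTopology (f := fun a : ℕ => 2 * a + i)).comp (continuous_apply 0)
  exact continuous_id.update 0 h

/-- The two components of the isomorphism `O(𝒩) ≅ O(𝒩) × O(𝒩)` that comes from splitting the Baire
space into two clopen copies of itself. -/
def half (i : ℕ) (O : OpenSubsets Baire) : OpenSubsets Baire :=
  ⟨intoHalf i ⁻¹' {g | g ∈ O}, by
    have h : IsOpen[repTopology Baire] {g | g ∈ O} := O.2
    rw [repTopology_baire] at h ⊢
    exact h.preimage (continuous_intoHalf i)⟩

/-- The map `r : O(𝒩) → 𝒩 × O(𝒩)`. -/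
noncomputable def retraction (O : OpenSubsets Baire) : Baire × OpenSubsets Baire :=
  (decodeSeq (half 0 O), half 1 O)

/-- The set `E = {(f, O) | f ∈ O}`. -/
def membershipSet : Set (Baire × OpenSubsets Baire) := {z | z.1 ∈ z.2}

/-!
The canonical topology of `O(𝒩)`. A name of an open set lists pairs `(u, v)` of finite sequences, and
the open set is the union of the cylinders of those `u` that are listed with a nonzero `v`
(`mem_iff_of_isName`). Hence every name presents its open set as the union of an increasing sequence
of open sets, each determined by a finite prefix of the name, so Scott open sets are open in the
canonical topology. Conversely, a finite prefix of a name fixes only finitely many values of the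
realizer, and all other values may be delayed (`Describes.exists_isName_mem`). This shows that sets
that are open in the canonical topology are upper sets and inaccessible by unions of increasing
sequences, and since `𝒩` is hereditarily Lindelöf, by directed unions.

The section. The decoding of the complement of `{c_{n,f(n)} | f(n) ≥ 1}` is `f`. This complement is
the increasing union of its parts consisting of the `g` with `g 0 < m`, and these depend on finitely
many values of `f` only; so the map is continuous into the Scott topology, also jointly with the
second component (`continuous_retractionSection`).

Effectivity. If the constant sequence `n` belongs to `O`, this is witnessed by a finite prefix, which
also puts almost all `c_{n,k}` into `O`. So `f n = a` is a combination of `Σ⁰₁` and `Π⁰₁` conditions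
and bounded quantifiers (`DecodesTo`), and such combinations are `Σ⁰₂` (`IsSigma2Rel`). As a name of
the second half of `O` is computable from a name of `O` (`isName_half_one`), a specific name of `r(O)`
has a `Σ⁰₂` graph. Now `r(O) ∈ U` says that a name of `U` lists a pair with nonzero second component
whose first component is a prefix of this specific name, and `r(O) ∈ E` is expressed similarly by the
name of the second half and the decoding of the first. Allowing all names of `r(O)` instead would not
do: which finite sequences are prefixes of names of a given open set is a `Π¹₁` question.

Non-Borelness. If `A = r⁻¹(E)` were Borel, so would be `E = s⁻¹(A)` for the product topology. As `𝒩`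
is second countable, membership of `(f, O)` in a Borel set of the product depends, besides `f`, only
on which members of some countable family of Scott open sets contain `O` (`CountablyDetermined`). For
`E` such a family would separate `𝒩` from every `𝒩 \ {f}`. But the `f` that are handled by one Scott
open set form a set that is bounded in each coordinate (`SeqScottOpen.exists_bound`), and a diagonal
argument shows that countably many such sets do not cover `𝒩`.
-/

/-! ### Prefixes and open sets of the Baire space -/

theorem isPrefixOf_iff {u : List ℕ} {q : Baire} :
    IsPrefixOf u q ↔ ∀ j < u.length, q j = u.getD j 0 := by
  unfold IsPrefixOf initialSegment
  constructor
  · intro h j hj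
    have h' : ((List.range u.length).map q)[j]? = u[j]? := by rw [h]
    rw [List.getD_eq_getElem?_getD, ← h']
    simp [hj]
  · intro h
    refine List.ext_getElem (by simp) fun j h₁ h₂ => ?_
    simp [h j h₂, h₂]

theorem isPrefixOf_initialSegment_iff {p q : Baire} {k : ℕ} :
    IsPrefixOf (initialSegment q k) p ↔ ∀ j < k, p j = q j := by
  simp [IsPrefixOf, initialSegment]

theorem getD_initialSegment {p : Baire} {k j : ℕ} (h : j < k) :
    (initialSegment p k).getD j 0 = p j := by
  simp [initialSegment, h]

theorem length_initialSegment (p : Baire) (k : ℕ) : (initialSegment p k).length = k := by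
  simp [initialSegment]

theorem IsPrefixOf.congr {u : List ℕ} {q q' : Baire} (h : IsPrefixOf u q)
    (hq : ∀ j < u.length, q' j = q j) : IsPrefixOf u q' :=
  isPrefixOf_iff.2 fun j hj => (hq j hj).trans (isPrefixOf_iff.1 h j hj)

theorem isOpen_baire_iff {V : Set Baire} :
    IsOpen V ↔ ∀ p ∈ V, ∃ k, ∀ p' : Baire, (∀ i < k, p' i = p i) → p' ∈ V := by
  constructor
  · intro hV p hp
    obtain ⟨I, W, hW, hWV⟩ := isOpen_pi_iff.1 hV p hp
    obtain ⟨N, hN⟩ := I.exists_nat_subset_range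
    refine ⟨N, fun p' h => hWV fun i hi => ?_⟩
    rw [h i (Finset.mem_range.1 (hN hi))]
    exact (hW i hi).2
  · intro h
    refine isOpen_iff_forall_mem_open.2 fun p hp => ?_
    obtain ⟨k, hk⟩ := h p hp
    exact ⟨PiNat.cylinder p k, fun p' hp' => hk p' hp', PiNat.isOpen_cylinder _ p k,
      PiNat.self_mem_cylinder p k⟩

/-! ### Open subsets of the Baire space and their names -/

namespace OpenSubsets

theorem isOpen_coe (O : OpenSubsets Baire) : IsOpen (O : Set Baire) := by
  have h : IsOpen[repTopology Baire] (O : Set Baire) := O.2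
  rwa [repTopology_baire] at h

/-- An open set in the usual topology of the Baire space as a point of `O(𝒩)`. -/
def ofIsOpen (S : Set Baire) (hS : IsOpen S) : OpenSubsets Baire :=
  ⟨S, by rwa [repTopology_baire]⟩

theorem exists_cylinder {O : OpenSubsets Baire} {q : Baire} (hq : q ∈ O) :
    ∃ k, ∀ q' : Baire, (∀ i < k, q' i = q i) → q' ∈ O :=
  isOpen_baire_iff.1 O.isOpen_coe q hq

end OpenSubsets

/-- A finite sequence that forces every extension to be a name of `⊤` in the Sierpiński space. -/
def Hits (v : List ℕ) : Prop := ∃ l, v.getD l 0 ≠ 0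

theorem exists_ne_zero_of_hits {v : List ℕ} {p : Baire} (hv : Hits v) (h : IsPrefixOf v p) :
    ∃ n < v.length, p n ≠ 0 := by
  obtain ⟨l, hl⟩ := hv
  have hlv : l < v.length := by
    by_contra hlv
    exact hl (List.getD_eq_default _ _ (not_lt.1 hlv))
  exact ⟨l, hlv, by rwa [isPrefixOf_iff.1 h l hlv]⟩

theorem hits_initialSegment {p : Baire} {n : ℕ} (h : p n ≠ 0) :
    Hits (initialSegment p (n + 1)) :=
  ⟨n, by rwa [getD_initialSegment n.lt_succ_self]⟩

/-- The pair of finite sequences with a given code. -/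
def pairOf (c : ℕ) : List ℕ × List ℕ := Denumerable.ofNat (List ℕ × List ℕ) c

@[simp]
theorem pairOf_encode (z : List ℕ × List ℕ) : pairOf (Encodable.encode z) = z :=
  Denumerable.ofNat_encode z

@[simp]
theorem encode_pairOf (c : ℕ) : Encodable.encode (pairOf c) = c :=
  Denumerable.encode_ofNat c

theorem listsPair_iff {p : Baire} {u v : List ℕ} :
    ListsPair p u v ↔ ∃ i, pairOf (p i) = (u, v) := by
  refine exists_congr fun i => ⟨fun h => by rw [h, pairOf_encode], fun h => ?_⟩
  rw [← h, encode_pairOf]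

theorem listsPair_pairOf (p : Baire) (i : ℕ) : ListsPair p (pairOf (p i)).1 (pairOf (p i)).2 :=
  listsPair_iff.2 ⟨i, rfl⟩

/-- A point belongs to an open set iff a name of the open set lists a pair `(u, v)` with `u` a prefix
of a given name of the point and `v` nonzero somewhere. -/
theorem mem_iff_of_isName {X : Type} [RepresentedSpace X] {p q : Baire} {U : OpenSubsets X} {x : X}
    (hp : IsName p U) (hq : IsName q x) :
    x ∈ U ↔ ∃ i, Hits (pairOf (p i)).2 ∧ IsPrefixOf (pairOf (p i)).1 q := by
  obtain ⟨F, hF⟩ := hp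
  obtain ⟨h₁, h₂, h₃⟩ := hF q x hq
  have h₁ : x ∈ U ↔ ∃ n, F q n ≠ 0 := h₁
  rw [h₁]
  constructor
  · rintro ⟨n, hn⟩
    obtain ⟨u, hu, huv⟩ := h₃ _ (isPrefixOf_initialSegment (F q) (n + 1))
    obtain ⟨i, hi⟩ := listsPair_iff.1 huv
    exact ⟨i, by rw [hi]; exact hits_initialSegment hn, by rwa [hi]⟩
  · rintro ⟨i, hv, hu⟩
    obtain ⟨n, -, hn⟩ := exists_ne_zero_of_hits hv (h₂ _ _ (listsPair_pairOf p i) hu)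
    exact ⟨n, hn⟩

/-- The list of pairs encoded by `p` describes the (continuous) map `F`. -/
def Describes (p : Baire) (F : Baire → Baire) : Prop :=
  ∀ q, (∀ u v, ListsPair p u v → IsPrefixOf u q → IsPrefixOf v (F q)) ∧
    ∀ v, IsPrefixOf v (F q) → ∃ u, IsPrefixOf u q ∧ ListsPair p u v

theorem isName_iff_describes {p : Baire} {O : OpenSubsets Baire} :
    IsName p O ↔ ∃ F, Describes p F ∧ ∀ q, q ∈ O ↔ ∃ n, F q n ≠ 0 := by
  constructor
  · rintro ⟨F, hF⟩
    exact ⟨F, fun q => (hF q q rfl).2, fun q => (hF q q rfl).1⟩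
  · rintro ⟨F, hF, h⟩
    refine ⟨F, ?_⟩
    rintro q x rfl
    exact ⟨h q, hF q⟩

theorem Describes.exists_modulus {p : Baire} {F : Baire → Baire} (hF : Describes p F) (q : Baire)
    (N : ℕ) : ∃ k, ∀ q' : Baire, (∀ i < k, q' i = q i) → ∀ n < N, F q' n = F q n := by
  obtain ⟨u, hu, huv⟩ := (hF q).2 _ (isPrefixOf_initialSegment (F q) N)
  refine ⟨u.length, fun q' hq' n hn => ?_⟩
  exact isPrefixOf_initialSegment_iff.1 ((hF q').1 _ _ huv (hu.congr hq')) n hn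

open Classical in
/-- A continuous map has a description that starts with any given finite list of correct pairs. -/
theorem exists_describes {G : Baire → Baire}
    (hG : ∀ q N, ∃ k, ∀ q' : Baire, (∀ i < k, q' i = q i) → ∀ n < N, G q' n = G q n)
    {p : Baire} {k : ℕ}
    (hp : ∀ i < k, ∀ q, IsPrefixOf (pairOf (p i)).1 q → IsPrefixOf (pairOf (p i)).2 (G q)) :
    ∃ p' : Baire, (∀ i < k, p' i = p i) ∧ Describes p' G := by
  let p' : Baire := fun i => if i < k then p i else
    if ∀ q, IsPrefixOf (pairOf (i - k)).1 q → IsPrefixOf (pairOf (i - k)).2 (G q)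
      then i - k else Encodable.encode (([], []) : List ℕ × List ℕ)
  refine ⟨p', fun i hi => if_pos hi, fun q => ⟨fun u v huv hu => ?_, fun v hv => ?_⟩⟩
  · obtain ⟨i, hi⟩ := listsPair_iff.1 huv
    simp only [p'] at hi
    split_ifs at hi with h₁ h₂
    · have := hp i h₁ q
      rw [hi] at this
      exact this hu
    · have := h₂ q
      rw [hi] at this
      exact this hu
    · rw [pairOf_encode] at hi
      obtain rfl : [] = v := (Prod.mk.inj hi).2
      rfl
  · obtain ⟨l, hl⟩ := hG q v.length
    refine ⟨initialSegment q l, isPrefixOf_initialSegment q l, listsPair_iff.2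
      ⟨k + Encodable.encode (initialSegment q l, v), ?_⟩⟩
    simp only [p']
    rw [if_neg (by omega), Nat.add_sub_cancel_left, pairOf_encode, if_pos, pairOf_encode]
    exact fun q' hq' => hv.congr (hl q' (isPrefixOf_initialSegment_iff.1 hq'))

open Classical in
/-- Within a neighbourhood of a description of `F`, only finitely much of the values of `F` is
fixed. Hence there are names of every open set that is compatible with these values: the remaining
values may be delayed. -/
theorem Describes.exists_isName_mem {p : Baire} {F : Baire → Baire} (hF : Describes p F)
    {V : Set Baire} (hV : IsOpen V) (hp : p ∈ V) :
    ∃ m, ∀ O : OpenSubsets Baire, (∀ q, ∀ n < m, F q n ≠ 0 → q ∈ O) → ∃ p' ∈ V, IsName p' O := by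
  obtain ⟨k, hk⟩ := isOpen_baire_iff.1 hV p hp
  obtain ⟨m, hm⟩ : ∃ m, ∀ i < k, (pairOf (p i)).2.length ≤ m :=
    ⟨(Finset.range k).sup fun i => (pairOf (p i)).2.length, fun i hi =>
      Finset.le_sup (f := fun i => (pairOf (p i)).2.length) (Finset.mem_range.2 hi)⟩
  refine ⟨m, fun O hO => ?_⟩
  let G : Baire → Baire := fun q n => if n < m then F q n else
    if ∀ q' : Baire, (∀ i < n, q' i = q i) → q' ∈ O then 1 else 0
  have hG : ∀ q N, ∃ l, ∀ q' : Baire, (∀ i < l, q' i = q i) → ∀ n < N, G q' n = G q n := by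
    intro q N
    obtain ⟨l, hl⟩ := hF.exists_modulus q m
    refine ⟨max l N, fun q' hq' n hn => ?_⟩
    have h₁ : n < m → F q' n = F q n :=
      hl q' (fun i hi => hq' i (lt_max_of_lt_left hi)) n
    have h₂ : (∀ r : Baire, (∀ i < n, r i = q' i) → r ∈ O) ↔
        ∀ r : Baire, (∀ i < n, r i = q i) → r ∈ O := by
      refine forall_congr' fun r => imp_congr_left (forall₂_congr fun i hi => ?_)
      rw [hq' i (lt_max_of_lt_right (hi.trans hn))]
    simp only [G, h₂]
    split_ifs with h
    · exact h₁ h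
    all_goals rfl
  obtain ⟨p', hp', hd⟩ := exists_describes hG (p := p) (k := k) fun i hi q hu =>
    ((hF q).1 _ _ (listsPair_pairOf p i) hu).congr fun j hj => if_pos (hj.trans_le (hm i hi))
  refine ⟨p', hk p' hp', isName_iff_describes.2 ⟨G, hd, fun q => ⟨fun hq => ?_, ?_⟩⟩⟩
  · obtain ⟨l, hl⟩ := OpenSubsets.exists_cylinder hq
    refine ⟨max l m, ?_⟩
    simp only [G]
    rw [if_neg (by omega), if_pos fun q' hq' => hl q' fun i hi => hq' i (lt_max_of_lt_left hi)]
    exact one_ne_zero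
  · rintro ⟨n, hn⟩
    simp only [G] at hn
    split_ifs at hn with h₁ h₂
    · exact hO q n h₁ hn
    · exact h₂ q fun _ _ => rfl
    · exact absurd rfl hn

/-! ### The Scott topology -/

/-- Sequentially Scott open sets: upper sets that are inaccessible by unions of increasing
sequences. -/
def SeqScottOpen (𝒰 : Set (OpenSubsets Baire)) : Prop :=
  IsUpperSet 𝒰 ∧ ∀ (O : ℕ → OpenSubsets Baire) (P : OpenSubsets Baire), Monotone O →
    (∀ q, q ∈ P ↔ ∃ n, q ∈ O n) → P ∈ 𝒰 → ∃ n, O n ∈ 𝒰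

open Classical in
theorem seqScottOpen_of_isOpen {𝒰 : Set (OpenSubsets Baire)}
    (h : IsOpen[repTopology (OpenSubsets Baire)] 𝒰) : SeqScottOpen 𝒰 := by
  obtain ⟨V, hV, hUV⟩ := h
  constructor
  · intro O O' hOO' hO
    obtain ⟨p, hp⟩ := RepresentedSpace.onto O
    obtain ⟨F, hF, hFO⟩ := isName_iff_describes.1 hp
    obtain ⟨m, hm⟩ := hF.exists_isName_mem hV ((hUV p O hp).1 hO)
    obtain ⟨p', hp', hpO⟩ := hm O' fun q n _ hn => hOO' ((hFO q).2 ⟨n, hn⟩)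
    exact (hUV p' O' hpO).2 hp'
  · intro O P hO hP hPU
    -- this realizer of `P` may only use `O n` for its `n`-th value
    let G : Baire → Baire := fun q n =>
      if ∀ q' : Baire, (∀ i < n, q' i = q i) → q' ∈ O n then 1 else 0
    have hG : ∀ q N, ∃ l, ∀ q' : Baire, (∀ i < l, q' i = q i) → ∀ n < N, G q' n = G q n := by
      intro q N
      refine ⟨N, fun q' hq' n hn => ?_⟩
      have h₂ : (∀ r : Baire, (∀ i < n, r i = q' i) → r ∈ O n) ↔
          ∀ r : Baire, (∀ i < n, r i = q i) → r ∈ O n := by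
        refine forall_congr' fun r => imp_congr_left (forall₂_congr fun i hi => ?_)
        rw [hq' i (hi.trans hn)]
      simp only [G, h₂]
    have hG1 : ∀ q n, G q n ≠ 0 → q ∈ O n := by
      intro q n hn
      by_contra hq
      exact hn (if_neg fun h => hq (h q fun _ _ => rfl))
    obtain ⟨p, -, hp⟩ := exists_describes hG (p := 0) (k := 0) (by simp)
    have hpP : IsName p P := isName_iff_describes.2 ⟨G, hp, fun q => ⟨fun hq => ?_, ?_⟩⟩
    · obtain ⟨m, hm⟩ := hp.exists_isName_mem hV ((hUV p P hpP).1 hPU)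
      obtain ⟨p', hp', hpO⟩ := hm (O m) fun q n hnm hn => hO hnm.le (hG1 q n hn)
      exact ⟨m, (hUV p' _ hpO).2 hp'⟩
    · obtain ⟨n, hn⟩ := (hP q).1 hq
      obtain ⟨l, hl⟩ := OpenSubsets.exists_cylinder hn
      refine ⟨max l n, ?_⟩
      simp only [G]
      rw [if_pos fun q' hq' => hO (le_max_right l n)
        (hl q' fun i hi => hq' i (lt_max_of_lt_left hi))]
      exact one_ne_zero
    · rintro ⟨n, hn⟩
      exact (hP q).2 ⟨n, hG1 q n hn⟩

/-- The part of an open set that is announced by the first `k` entries of a name. -/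
def announced (p : Baire) (k : ℕ) : OpenSubsets Baire :=
  OpenSubsets.ofIsOpen {q | ∃ i < k, Hits (pairOf (p i)).2 ∧ IsPrefixOf (pairOf (p i)).1 q} <| by
    refine isOpen_baire_iff.2 ?_
    rintro q ⟨i, hi, hv, hu⟩
    exact ⟨_, fun q' hq' => ⟨i, hi, hv, hu.congr hq'⟩⟩

theorem SeqScottOpen.isOpen {𝒰 : Set (OpenSubsets Baire)} (h : SeqScottOpen 𝒰) :
    IsOpen[repTopology (OpenSubsets Baire)] 𝒰 := by
  refine ⟨{p | ∃ k, announced p k ∈ 𝒰}, isOpen_baire_iff.2 ?_, fun p O hp => ⟨fun hO => ?_, ?_⟩⟩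
  · rintro p ⟨k, hk⟩
    refine ⟨k, fun p' hp' => ⟨k, ?_⟩⟩
    have : announced p' k = announced p k := by
      refine SetLike.ext fun q => exists_congr fun i => and_congr_right fun hi => ?_
      rw [hp' i hi]
    rwa [this]
  · refine h.2 (announced p) O ?_ (fun q => ?_) hO
    · rintro k l hkl q ⟨i, hi, hq⟩
      exact ⟨i, hi.trans_le hkl, hq⟩
    · rw [mem_iff_of_isName hp (rfl : IsName q q)]
      exact ⟨fun ⟨i, hi⟩ => ⟨i + 1, i, i.lt_succ_self, hi⟩, fun ⟨_, i, _, hi⟩ => ⟨i, hi⟩⟩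
  · rintro ⟨k, hk⟩
    refine h.1 ?_ hk
    rintro q ⟨i, -, hi⟩
    exact (mem_iff_of_isName hp (rfl : IsName q q)).2 ⟨i, hi⟩

theorem isOpen_iff_seqScottOpen {𝒰 : Set (OpenSubsets Baire)} :
    IsOpen[repTopology (OpenSubsets Baire)] 𝒰 ↔ SeqScottOpen 𝒰 :=
  ⟨seqScottOpen_of_isOpen, SeqScottOpen.isOpen⟩

theorem mem_iff_of_isLUB {D : Set (OpenSubsets Baire)} {P : OpenSubsets Baire} (h : IsLUB D P)
    (q : Baire) : q ∈ P ↔ ∃ O ∈ D, q ∈ O := by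
  refine ⟨fun hq => ?_, fun ⟨O, hO, hq⟩ => h.1 hO hq⟩
  let Q : OpenSubsets Baire := OpenSubsets.ofIsOpen (⋃ O ∈ D, (O : Set Baire))
    (isOpen_biUnion fun O _ => O.isOpen_coe)
  have hPQ : P ≤ Q := h.2 fun O hO q hq => Set.mem_biUnion hO hq
  have hq : q ∈ ⋃ O ∈ D, (O : Set Baire) := hPQ hq
  simpa using hq

/-- As `𝒩` is hereditarily Lindelöf, unions of directed families are unions of increasing sequences
from the family. -/
theorem exists_monotone_seq {D : Set (OpenSubsets Baire)} (hD : D.Nonempty)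
    (hdir : DirectedOn (· ≤ ·) D) {P : OpenSubsets Baire} (h : IsLUB D P) :
    ∃ O : ℕ → OpenSubsets Baire, Monotone O ∧ (∀ n, O n ∈ D) ∧ ∀ q, q ∈ P ↔ ∃ n, q ∈ O n := by
  obtain ⟨T, hT, hTD⟩ := TopologicalSpace.isOpen_iUnion_countable
    (fun O : D => ((O : OpenSubsets Baire) : Set Baire)) fun O => O.1.isOpen_coe
  obtain ⟨O₀, hO₀⟩ := hD
  obtain ⟨e, he⟩ := (hT.insert ⟨O₀, hO₀⟩).exists_eq_range (Set.insert_nonempty _ _)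
  choose j hjD hj using hdir
  let O : ℕ → D := fun n =>
    Nat.rec (e 0) (fun n a => ⟨j a a.2 (e (n + 1)) (e (n + 1)).2, hjD _ _ _ _⟩) n
  have hs : ∀ n, O n ≤ O (n + 1) ∧ e (n + 1) ≤ O (n + 1) := fun n => hj _ (O n).2 _ (e (n + 1)).2
  refine ⟨fun n => (O n).1, monotone_nat_of_le_succ fun n => (hs n).1, fun n => (O n).2, fun q => ?_⟩
  · refine ⟨fun hq => ?_, fun ⟨n, hn⟩ => h.1 (O n).2 hn⟩
    obtain ⟨Q, hQ, hqQ⟩ := (mem_iff_of_isLUB h q).1 hq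
    have hq' : q ∈ ⋃ O : D, ((O : OpenSubsets Baire) : Set Baire) :=
      Set.mem_iUnion.2 ⟨⟨Q, hQ⟩, hqQ⟩
    rw [← hTD] at hq'
    obtain ⟨R, hR, hqR⟩ := Set.mem_iUnion₂.1 hq'
    obtain ⟨n, rfl⟩ : R ∈ Set.range e := he ▸ Set.mem_insert_of_mem _ hR
    refine ⟨n, ?_⟩
    cases n with
    | zero => exact hqR
    | succ n => exact (hs n).2 hqR

theorem repTopology_openSubsets_baire :
    repTopology (OpenSubsets Baire) = Topology.scott (OpenSubsets Baire) Set.univ := by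
  refine TopologicalSpace.ext_iff.2 fun 𝒰 => ?_
  let := Topology.scott (OpenSubsets Baire) Set.univ
  have : Topology.IsScott (OpenSubsets Baire) Set.univ := ⟨rfl⟩
  rw [isOpen_iff_seqScottOpen,
    Topology.IsScott.isOpen_iff_isUpperSet_and_dirSupInaccOn (D := Set.univ)]
  refine and_congr_right fun hup => ⟨fun h D _ hD hdir P hP hPU => ?_, fun h O P hO hP hPU => ?_⟩
  · obtain ⟨O, hO, hOD, hPO⟩ := exists_monotone_seq hD hdir hP
    obtain ⟨n, hn⟩ := h O P hO hPO hPU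
    exact ⟨O n, hOD n, hn⟩
  · have hlub : IsLUB (Set.range O) P := by
      refine ⟨?_, fun Q hQ q hq => ?_⟩
      · rintro _ ⟨n, rfl⟩ q hq
        exact (hP q).2 ⟨n, hq⟩
      · obtain ⟨n, hn⟩ := (hP q).1 hq
        exact hQ ⟨n, rfl⟩ hn
    obtain ⟨_, ⟨n, rfl⟩, hn⟩ := h trivial (Set.range_nonempty O)
      (directedOn_range.2 hO.directed_le) hlub hPU
    exact ⟨n, hn⟩

/-! ### The values of the decoding map -/

theorem bumpSeq_self (n k : ℕ) : bumpSeq n k k = n + 1 := by simp [bumpSeq]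

theorem bumpSeq_of_ne {n k j : ℕ} (h : j ≠ k) : bumpSeq n k j = n := by simp [bumpSeq, h]

theorem exists_bumpSeq_mem {O : OpenSubsets Baire} {n : ℕ} (h : (fun _ => n : Baire) ∈ O) :
    ∃ N, ∀ k ≥ N, bumpSeq n k ∈ O := by
  obtain ⟨N, hN⟩ := OpenSubsets.exists_cylinder h
  exact ⟨N, fun k hk => hN _ fun i hi => bumpSeq_of_ne (hi.trans_le hk).ne⟩

theorem decodeSeq_of_notMem {O : OpenSubsets Baire} {n : ℕ} (h : (fun _ => n : Baire) ∉ O) :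
    decodeSeq O n = 0 := if_neg h

theorem decodeSeq_eq_iff {O : OpenSubsets Baire} {n a : ℕ} (h : (fun _ => n : Baire) ∈ O) :
    decodeSeq O n = a ↔ (∀ k > a, bumpSeq n k ∈ O) ∧ (a = 0 ∨ bumpSeq n a ∉ O) := by
  have he : decodeSeq O n = sSup {k : ℕ | 1 ≤ k ∧ bumpSeq n k ∉ O} := if_pos h
  rw [he]
  have hb : BddAbove {k : ℕ | 1 ≤ k ∧ bumpSeq n k ∉ O} := by
    obtain ⟨N, hN⟩ := exists_bumpSeq_mem h
    refine ⟨N, fun k hk => ?_⟩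
    by_contra hNk
    exact hk.2 (hN k (not_le.1 hNk).le)
  constructor
  · rintro rfl
    refine ⟨fun k hk => ?_, ?_⟩
    · by_contra hkO
      exact absurd (le_csSup hb ⟨by omega, hkO⟩) (not_le.2 hk)
    · rcases Set.eq_empty_or_nonempty {k : ℕ | 1 ≤ k ∧ bumpSeq n k ∉ O} with h0 | h0
      · exact Or.inl (by rw [h0, csSup_empty]; rfl)
      · exact Or.inr (Nat.sSup_mem h0 hb).2
  · rintro ⟨h₁, h₂⟩
    refine le_antisymm (csSup_le' fun k hk => ?_) ?_
    · by_contra hak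
      exact hk.2 (h₁ k (not_le.1 hak))
    · rcases h₂ with rfl | h₂
      · exact Nat.zero_le _
      · rcases Nat.eq_zero_or_pos a with rfl | ha
        · exact Nat.zero_le _
        · exact le_csSup hb ⟨ha, h₂⟩

/-! ### A continuous section -/

/-- The left inverse of both maps `intoHalf 0` and `intoHalf 1`. -/
def outOfHalf (g : Baire) : Baire := Function.update g 0 (g 0 / 2)

theorem intoHalf_zero (i : ℕ) (g : Baire) : intoHalf i g 0 = 2 * g 0 + i := by simp [intoHalf]

theorem outOfHalf_intoHalf {i : ℕ} (hi : i < 2) (g : Baire) : outOfHalf (intoHalf i g) = g := by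
  have : (2 * g 0 + i) / 2 = g 0 := by omega
  simp [outOfHalf, intoHalf, this]

theorem mem_half {i : ℕ} {O : OpenSubsets Baire} {g : Baire} : g ∈ half i O ↔ intoHalf i g ∈ O :=
  Iff.rfl

open Classical in
/-- The open set with given halves. -/
def joinHalves (A B : OpenSubsets Baire) : OpenSubsets Baire :=
  OpenSubsets.ofIsOpen {g | outOfHalf g ∈ if g 0 % 2 = 0 then A else B} <| by
    refine isOpen_baire_iff.2 fun g hg => ?_
    obtain ⟨k, hk⟩ := OpenSubsets.exists_cylinder (Set.mem_ofPred.1 hg)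
    refine ⟨k + 1, fun g' h' => ?_⟩
    have h0 : g' 0 = g 0 := h' 0 k.succ_pos
    simp only [Set.mem_ofPred, h0]
    refine hk _ fun i hi => ?_
    rcases eq_or_ne i 0 with rfl | hi0
    · simp [outOfHalf, h0]
    · simp [outOfHalf, hi0, h' i (by omega)]

theorem mem_joinHalves {A B : OpenSubsets Baire} {g : Baire} :
    g ∈ joinHalves A B ↔ outOfHalf g ∈ if g 0 % 2 = 0 then A else B := Iff.rfl

theorem half_zero_joinHalves (A B : OpenSubsets Baire) : half 0 (joinHalves A B) = A := by
  refine SetLike.ext fun g => ?_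
  rw [mem_half, mem_joinHalves, outOfHalf_intoHalf two_pos, intoHalf_zero, if_pos (by omega)]

theorem half_one_joinHalves (A B : OpenSubsets Baire) : half 1 (joinHalves A B) = B := by
  refine SetLike.ext fun g => ?_
  rw [mem_half, mem_joinHalves, outOfHalf_intoHalf one_lt_two, intoHalf_zero, if_neg (by omega)]

theorem joinHalves_mono {A A' B B' : OpenSubsets Baire} (hA : A ≤ A') (hB : B ≤ B') :
    joinHalves A B ≤ joinHalves A' B' := by
  intro g hg
  have hg : g ∈ joinHalves A B := hg
  change g ∈ joinHalves A' B'
  rw [mem_joinHalves] at hg ⊢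
  split_ifs at hg ⊢ with h
  · exact hA hg
  · exact hB hg

/-- The sequences `g` with `g 0 < m` that differ from all `c_{n,f(n)}` with `f(n) ≥ 1`. As
`c_{n,k}` has first value `n` for `k ≥ 1`, only `n = g 0` matters. -/
def avoidBumpsBelow (f : Baire) (m : ℕ) : OpenSubsets Baire :=
  OpenSubsets.ofIsOpen {g | g 0 < m ∧ (f (g 0) = 0 ∨ g ≠ bumpSeq (g 0) (f (g 0)))} <| by
    refine isOpen_baire_iff.2 ?_
    rintro g ⟨hm, h | h⟩
    · refine ⟨1, fun g' hg' => ?_⟩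
      have h0 : g' 0 = g 0 := hg' 0 one_pos
      exact ⟨by rwa [h0], Or.inl (by rwa [h0])⟩
    · obtain ⟨j, hj⟩ := Function.ne_iff.1 h
      refine ⟨j + 1, fun g' hg' => ?_⟩
      have h0 : g' 0 = g 0 := hg' 0 j.succ_pos
      refine ⟨by rwa [h0], Or.inr fun h' => hj ?_⟩
      rw [← hg' j j.lt_succ_self, h', h0]

/-- The complement of the set of all `c_{n,f(n)}` with `f(n) ≥ 1`; it is decoded to `f`. -/
def avoidBumps (f : Baire) : OpenSubsets Baire :=
  OpenSubsets.ofIsOpen (⋃ m, (avoidBumpsBelow f m : Set Baire))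
    (isOpen_iUnion fun m => (avoidBumpsBelow f m).isOpen_coe)

theorem mem_avoidBumps_iff_exists {f g : Baire} :
    g ∈ avoidBumps f ↔ ∃ m, g ∈ avoidBumpsBelow f m := Set.mem_iUnion

theorem mem_avoidBumps {f g : Baire} :
    g ∈ avoidBumps f ↔ f (g 0) = 0 ∨ g ≠ bumpSeq (g 0) (f (g 0)) := by
  rw [mem_avoidBumps_iff_exists]
  exact ⟨fun ⟨_, h⟩ => h.2, fun h => ⟨g 0 + 1, Nat.lt_succ_self _, h⟩⟩

theorem decodeSeq_avoidBumps (f : Baire) : decodeSeq (avoidBumps f) = f := by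
  funext n
  have hc : (fun _ => n : Baire) ∈ avoidBumps f := by
    refine mem_avoidBumps.2 (Or.inr fun h => ?_)
    have := congrFun h (f n)
    rw [bumpSeq_self] at this
    omega
  refine (decodeSeq_eq_iff hc).2 ⟨fun k hk => ?_, ?_⟩
  · refine mem_avoidBumps.2 (Or.inr fun h => ?_)
    rw [bumpSeq_of_ne (by omega : 0 ≠ k)] at h
    have := congrFun h k
    rw [bumpSeq_self, bumpSeq_of_ne (by omega)] at this
    omega
  · refine or_iff_not_imp_left.2 fun h => ?_
    rw [mem_avoidBumps, bumpSeq_of_ne (by omega)]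
    simpa using h

/-- The section of the retraction. -/
def retractionSection (z : Baire × OpenSubsets Baire) : OpenSubsets Baire :=
  joinHalves (avoidBumps z.1) z.2

theorem retraction_retractionSection (z : Baire × OpenSubsets Baire) :
    retraction (retractionSection z) = z := by
  simp [retraction, retractionSection, half_zero_joinHalves, half_one_joinHalves,
    decodeSeq_avoidBumps]

theorem SeqScottOpen.preimage_joinHalves {𝒰 : Set (OpenSubsets Baire)} (h : SeqScottOpen 𝒰)
    (A : OpenSubsets Baire) : SeqScottOpen {O | joinHalves A O ∈ 𝒰} := by
  refine ⟨fun O O' hO h' => h.1 (joinHalves_mono le_rfl hO) h', fun O P hO hP hPU => ?_⟩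
  refine h.2 (fun n => joinHalves A (O n)) _ (fun m n hmn => joinHalves_mono le_rfl (hO hmn))
    (fun q => ?_) hPU
  simp only [mem_joinHalves]
  split_ifs
  · exact ⟨fun h => ⟨0, h⟩, fun ⟨_, h⟩ => h⟩
  · exact hP _

theorem continuous_retractionSection :
    @Continuous (Baire × OpenSubsets Baire) (OpenSubsets Baire)
      (@instTopologicalSpaceProd Baire (OpenSubsets Baire)
        (repTopology Baire) (repTopology (OpenSubsets Baire)))
      (repTopology (OpenSubsets Baire)) retractionSection := by
  let := repTopology (OpenSubsets Baire)
  rw [repTopology_baire]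
  refine continuous_def.2 fun 𝒰 h𝒰 => isOpen_prod_iff.2 fun f O hfO => ?_
  have hU := isOpen_iff_seqScottOpen.1 h𝒰
  obtain ⟨m, hm⟩ := hU.2 (fun m => joinHalves (avoidBumpsBelow f m) O) (joinHalves (avoidBumps f) O)
    (fun m n hmn => joinHalves_mono (fun g hg => ⟨hg.1.trans_le hmn, hg.2⟩) le_rfl)
    (fun q => by
      simp only [mem_joinHalves]
      split_ifs
      · exact mem_avoidBumps_iff_exists
      · exact ⟨fun h => ⟨0, h⟩, fun ⟨_, h⟩ => h⟩) hfO
  refine ⟨PiNat.cylinder f m, {O' | joinHalves (avoidBumpsBelow f m) O' ∈ 𝒰},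
    PiNat.isOpen_cylinder _ f m, isOpen_iff_seqScottOpen.2 (hU.preimage_joinHalves _),
    PiNat.self_mem_cylinder f m, hm, ?_⟩
  rintro ⟨f', O'⟩ ⟨hf', hO'⟩
  refine hU.1 (joinHalves_mono (fun g hg => ?_) le_rfl) hO'
  -- `f'` agrees with `f` at all first values below `m`
  have hg : g 0 < m ∧ _ := hg
  refine mem_avoidBumps.2 ?_
  have hff : f' (g 0) = f (g 0) := hf' _ hg.1
  dsimp only
  rw [hff]
  exact hg.2

/-! ### Non-Borelness -/

/-- The sections `{O | (f, O) ∈ S}` depend only on the membership of `O` in countably many Scott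
open sets, which do not depend on `f`. -/
def CountablyDetermined (S : Set (Baire × OpenSubsets Baire)) : Prop :=
  ∃ 𝒰 : ℕ → Set (OpenSubsets Baire), (∀ i, SeqScottOpen (𝒰 i)) ∧
    ∀ f O O', (∀ i, O ∈ 𝒰 i ↔ O' ∈ 𝒰 i) → ((f, O) ∈ S ↔ (f, O') ∈ S)

theorem CountablyDetermined.compl {S : Set (Baire × OpenSubsets Baire)}
    (h : CountablyDetermined S) : CountablyDetermined Sᶜ := by
  obtain ⟨𝒰, h𝒰, h⟩ := h
  exact ⟨𝒰, h𝒰, fun f O O' hO => not_congr (h f O O' hO)⟩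

theorem CountablyDetermined.iUnion {S : ℕ → Set (Baire × OpenSubsets Baire)}
    (h : ∀ n, CountablyDetermined (S n)) : CountablyDetermined (⋃ n, S n) := by
  choose 𝒰 h𝒰 h using h
  refine ⟨fun i => 𝒰 i.unpair.1 i.unpair.2, fun i => h𝒰 _ _, fun f O O' hO => ?_⟩
  simp only [Set.mem_iUnion]
  refine exists_congr fun n => h n f O O' fun i => ?_
  simpa using hO (Nat.pair n i)

theorem countablyDetermined_of_isOpen {S : Set (Baire × OpenSubsets Baire)}
    (hS : @IsOpen _ (@instTopologicalSpaceProd Baire (OpenSubsets Baire)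
      (repTopology Baire) (repTopology (OpenSubsets Baire))) S) : CountablyDetermined S := by
  let := repTopology (OpenSubsets Baire)
  rw [repTopology_baire] at hS
  -- for each cylinder, the largest open set such that their product lies in `S`
  let 𝒱 : List ℕ → Set (OpenSubsets Baire) := fun u =>
    ⋃₀ {𝒲 | IsOpen 𝒲 ∧ ∀ f O, IsPrefixOf u f → O ∈ 𝒲 → (f, O) ∈ S}
  have key : ∀ f O O', (∀ u, O ∈ 𝒱 u → O' ∈ 𝒱 u) → (f, O) ∈ S → (f, O') ∈ S := by
    intro f O O' hO hfO
    obtain ⟨A, 𝒲, hA, h𝒲, hfA, hO𝒲, hA𝒲⟩ := isOpen_prod_iff.1 hS f O hfO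
    obtain ⟨k, hk⟩ := isOpen_baire_iff.1 hA f hfA
    obtain ⟨𝒲', h', hO'⟩ := hO (initialSegment f k) ⟨𝒲, ⟨h𝒲, fun f' O' hf' hO' =>
      hA𝒲 ⟨hk f' (isPrefixOf_initialSegment_iff.1 hf'), hO'⟩⟩, hO𝒲⟩
    exact h'.2 f O' (isPrefixOf_initialSegment f k) hO'
  refine ⟨fun i => 𝒱 (Denumerable.ofNat (List ℕ) i), fun i => isOpen_iff_seqScottOpen.1
    (isOpen_sUnion fun 𝒲 h => h.1), fun f O O' hO => ?_⟩
  have hO : ∀ u, O ∈ 𝒱 u ↔ O' ∈ 𝒱 u := fun u => by simpa using hO (Encodable.encode u)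
  exact ⟨key f O O' fun u => (hO u).1, key f O' O fun u => (hO u).2⟩

/-- The set of points whose removal from `𝒩` leads out of a Scott open set is bounded: otherwise
it would contain a closed discrete sequence `x`, and `𝒩` would be the increasing union of the sets
`𝒩 \ {x j | j ≥ m}`, none of which belongs to the Scott open set. -/
theorem SeqScottOpen.exists_bound {𝒰 : Set (OpenSubsets Baire)} (h : SeqScottOpen 𝒰)
    {P : OpenSubsets Baire} (hP : ∀ q, q ∈ P) (hP𝒰 : P ∈ 𝒰) (n : ℕ) :
    ∃ b, ∀ x : Baire, (∀ O : OpenSubsets Baire, (∀ q, q ∈ O ↔ q ≠ x) → O ∉ 𝒰) → x n < b := by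
  by_contra! hx
  choose x hx hxn using hx
  let O : ℕ → OpenSubsets Baire := fun m =>
    OpenSubsets.ofIsOpen {g | ∀ j, m ≤ j → j ≤ g n → g ≠ x j} <| by
      have : {g : Baire | ∀ j, m ≤ j → j ≤ g n → g ≠ x j} =
          ⋃ c, ({g | g n = c} ∩ ⋂ j ∈ Finset.Icc m c, {x j}ᶜ) := by
        ext g
        simp
      rw [this]
      refine isOpen_iUnion fun c => IsOpen.inter ?_ ?_
      · have hc : Continuous fun g : Baire => g n := continuous_apply n
        exact (isOpen_discrete ({c} : Set ℕ)).preimage hc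
      · exact isOpen_biInter_finset fun j _ => isOpen_compl_singleton
  obtain ⟨m, hm⟩ := h.2 O P (fun m m' hmm' g hg j hj => hg j (hmm'.trans hj))
    (fun q => ⟨fun _ => ⟨q n + 1, fun j h₁ h₂ => by omega⟩, fun _ => hP q⟩) hP𝒰
  refine hx m (OpenSubsets.ofIsOpen {x m}ᶜ isOpen_compl_singleton) (fun q => Iff.rfl)
    (h.1 (fun g hg => ?_) hm)
  rintro rfl
  exact hg m le_rfl (hxn m) rfl

/-- Countably many Scott open sets cannot separate `𝒩` from all its subsets `𝒩 \ {f}`, because `𝒩`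
is not a countable union of bounded sets. -/
theorem not_countablyDetermined_membershipSet : ¬ CountablyDetermined membershipSet := by
  rintro ⟨𝒰, h𝒰, h⟩
  let P : OpenSubsets Baire := OpenSubsets.ofIsOpen Set.univ isOpen_univ
  have hb : ∀ i, ∃ b, P ∈ 𝒰 i → ∀ x : Baire,
      (∀ O : OpenSubsets Baire, (∀ q, q ∈ O ↔ q ≠ x) → O ∉ 𝒰 i) → x i < b := by
    intro i
    by_cases hi : P ∈ 𝒰 i
    · obtain ⟨b, hb⟩ := (h𝒰 i).exists_bound (P := P) (fun _ => Set.mem_univ _) hi i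
      exact ⟨b, fun _ => hb⟩
    · exact ⟨0, fun h => absurd h hi⟩
  choose b hb using hb
  let Q : OpenSubsets Baire := OpenSubsets.ofIsOpen {b}ᶜ isOpen_compl_singleton
  have hQP : Q ≤ P := fun _ _ => trivial
  have hmem := h b P Q fun i => by
    refine ⟨fun hi => ?_, fun hi => (h𝒰 i).1 hQP hi⟩
    by_contra hQ
    refine (hb i hi b fun O hO => ?_).false
    have : O = Q := SetLike.ext hO
    rwa [this]
  exact (hmem.1 trivial : b ∈ Q) rfl

theorem not_isBorelSubset_preimage_retraction :
    ¬ IsBorelSubset (retraction ⁻¹' membershipSet) := by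
  intro hA
  have key : ∀ A : Set (OpenSubsets Baire), IsBorelSubset A →
      CountablyDetermined (retractionSection ⁻¹' A) := by
    intro A hA
    induction A, hA using MeasurableSpace.generateFrom_induction with
    | hC t ht _ =>
      exact countablyDetermined_of_isOpen
        ((@continuous_def _ _ (_) (_) _).1 continuous_retractionSection t ht)
    | empty => exact ⟨fun _ => ∅, fun _ => ⟨isUpperSet_empty, fun _ _ _ _ h => h.elim⟩,
        fun _ _ _ _ => Iff.rfl⟩
    | compl t _ ih => exact ih.compl
    | iUnion t _ ih =>
      rw [Set.preimage_iUnion]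
      exact CountablyDetermined.iUnion ih
  refine not_countablyDetermined_membershipSet ?_
  have h := key _ hA
  rw [← Set.preimage_comp] at h
  rwa [show retraction ∘ retractionSection = id from funext retraction_retractionSection] at h

/-! ### Effective `Σ⁰₁` and `Σ⁰₂` relations -/

/-- Relations between elements of `α` and sequences that are witnessed by a natural number and a
finite prefix of the sequence, decided primitive recursively. -/
def IsSigma1Rel {α : Type} [Primcodable α] (R : α → Baire → Prop) : Prop :=
  ∃ P : (α × ℕ) × List ℕ → Bool, Primrec P ∧
    ∀ a p, R a p ↔ ∃ n m, P ((a, n), initialSegment p m) = true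

/-- Relations of the form `∃ n, ¬ R (a, n) p` with an effective `Σ⁰₁` relation `R`. -/
def IsSigma2Rel {α : Type} [Primcodable α] (R : α → Baire → Prop) : Prop :=
  ∃ R' : α × ℕ → Baire → Prop, IsSigma1Rel R' ∧ ∀ a p, R a p ↔ ∃ n, ¬ R' (a, n) p

section Relations

variable {α β : Type} [Primcodable α] [Primcodable β]

namespace IsSigma1Rel

theorem of_iff {R S : α → Baire → Prop} (hS : IsSigma1Rel S) (h : ∀ a p, R a p ↔ S a p) :
    IsSigma1Rel R := by
  obtain ⟨P, hP, hPS⟩ := hS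
  exact ⟨P, hP, fun a p => (h a p).trans (hPS a p)⟩

theorem of_primrec {Q : α → Bool} (hQ : Primrec Q) : IsSigma1Rel fun a _ => Q a = true :=
  ⟨fun z => Q z.1.1, hQ.comp (Primrec.fst.comp Primrec.fst), fun a p => by simp⟩

theorem of_primrecPred {Q : α → Prop} [DecidablePred Q] (hQ : PrimrecPred Q) :
    IsSigma1Rel fun a _ => Q a :=
  (of_primrec hQ.decide).of_iff fun a p => by simp

theorem getElem?_initialSegment (p : Baire) (m i : ℕ) :
    (initialSegment p m)[i]? = if i < m then some (p i) else none := by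
  split_ifs with h <;> simp [initialSegment, h]

/-- A decidable condition on one value of the sequence. -/
theorem eval {Q : α → ℕ → Bool} {g : α → ℕ} (hQ : Primrec₂ Q) (hg : Primrec g) :
    IsSigma1Rel fun a p => Q a (p (g a)) = true := by
  refine ⟨fun z => ((z.2[g z.1.1]?).map (Q z.1.1)).getD false, ?_, fun a p => ?_⟩
  · refine Primrec.option_getD.comp (Primrec.option_map (Primrec.list_getElem?.comp Primrec.snd
      (hg.comp (Primrec.fst.comp Primrec.fst))) ?_) (Primrec.const false)
    exact hQ.comp (Primrec.fst.comp (Primrec.fst.comp Primrec.fst)) Primrec.snd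
  · simp only [getElem?_initialSegment]
    refine ⟨fun h => ⟨0, g a + 1, by simpa using h⟩, ?_⟩
    rintro ⟨-, m, h⟩
    split_ifs at h
    · simpa using h
    · simp at h

theorem comp {R : α → Baire → Prop} (h : IsSigma1Rel R) {f : β → α} (hf : Primrec f) :
    IsSigma1Rel fun b => R (f b) := by
  obtain ⟨P, hP, hPR⟩ := h
  exact ⟨fun z => P ((f z.1.1, z.1.2), z.2), hP.comp (((hf.comp (Primrec.fst.comp Primrec.fst)).pair
    (Primrec.snd.comp Primrec.fst)).pair Primrec.snd), fun b p => hPR _ _⟩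

theorem ex {R : α × ℕ → Baire → Prop} (h : IsSigma1Rel R) :
    IsSigma1Rel fun a p => ∃ n, R (a, n) p := by
  obtain ⟨P, hP, hPR⟩ := h
  refine ⟨fun z => P (((z.1.1, z.1.2.unpair.1), z.1.2.unpair.2), z.2), ?_, fun a p => ?_⟩
  · have h₁ : Primrec fun z : (α × ℕ) × List ℕ => z.1.1 := Primrec.fst.comp Primrec.fst
    have h₂ : Primrec fun z : (α × ℕ) × List ℕ => z.1.2.unpair :=
      Primrec.unpair.comp (Primrec.snd.comp Primrec.fst)
    exact hP.comp (((h₁.pair (Primrec.fst.comp h₂)).pair (Primrec.snd.comp h₂)).pair Primrec.snd)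
  · simp only [hPR]
    refine ⟨fun ⟨n, k, m, h⟩ => ⟨Nat.pair n k, m, by simpa using h⟩, fun ⟨n, m, h⟩ => ⟨_, _, m, h⟩⟩

/-- The decision procedures are not monotone in the prefix, so the witness of a conjunction also
contains the lengths of the prefixes at which they succeed. -/
theorem and {R S : α → Baire → Prop} (hR : IsSigma1Rel R) (hS : IsSigma1Rel S) :
    IsSigma1Rel fun a p => R a p ∧ S a p := by
  obtain ⟨P, hP, hPR⟩ := hR
  obtain ⟨Q, hQ, hQS⟩ := hS
  let w : (α × ℕ) × List ℕ → ℕ × ℕ := fun z => z.1.2.unpair.1.unpair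
  let w' : (α × ℕ) × List ℕ → ℕ × ℕ := fun z => z.1.2.unpair.2.unpair
  have hw0 : Primrec fun z : (α × ℕ) × List ℕ => z.1.2.unpair :=
    Primrec.unpair.comp (Primrec.snd.comp Primrec.fst)
  have hw : Primrec w := Primrec.unpair.comp (Primrec.fst.comp hw0)
  have hw' : Primrec w' := Primrec.unpair.comp (Primrec.snd.comp hw0)
  have ha : Primrec fun z : (α × ℕ) × List ℕ => z.1.1 := Primrec.fst.comp Primrec.fst
  have htake : ∀ {w : (α × ℕ) × List ℕ → ℕ × ℕ}, Primrec w →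
      Primrec fun z => ((z.1.1, (w z).1), z.2.take (w z).2) := fun hw =>
    (ha.pair (Primrec.fst.comp hw)).pair
      (Primrec.list_take.comp (Primrec.snd.comp hw) Primrec.snd)
  have hseg : ∀ (p : Baire) (k m : ℕ),
      (initialSegment p m).take k = initialSegment p (min k m) := fun p k m => by
    simp [initialSegment, ← List.map_take, List.take_range]
  refine ⟨fun z => P ((z.1.1, (w z).1), z.2.take (w z).2) &&
    Q ((z.1.1, (w' z).1), z.2.take (w' z).2),
    Primrec.and.comp (hP.comp (htake hw)) (hQ.comp (htake hw')), fun a p => ?_⟩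
  simp only [hPR, hQS, hseg, Bool.and_eq_true]
  constructor
  · rintro ⟨⟨n, m, h⟩, n', m', h'⟩
    refine ⟨Nat.pair (Nat.pair n m) (Nat.pair n' m'), max m m', ?_⟩
    simp [w, w', h, h']
  · rintro ⟨n, m, h⟩
    exact ⟨⟨_, _, h.1⟩, _, _, h.2⟩

theorem or {R S : α → Baire → Prop} (hR : IsSigma1Rel R) (hS : IsSigma1Rel S) :
    IsSigma1Rel fun a p => R a p ∨ S a p := by
  obtain ⟨P, hP, hPR⟩ := hR
  obtain ⟨Q, hQ, hQS⟩ := hS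
  refine ⟨fun z => P z || Q z, Primrec.or.comp hP hQ, fun a p => ?_⟩
  simp only [hPR, hQS, Bool.or_eq_true, exists_or]

end IsSigma1Rel

namespace IsSigma2Rel

theorem of_iff {R S : α → Baire → Prop} (hS : IsSigma2Rel S) (h : ∀ a p, R a p ↔ S a p) :
    IsSigma2Rel R := by
  obtain ⟨P, hP, hPS⟩ := hS
  exact ⟨P, hP, fun a p => (h a p).trans (hPS a p)⟩

theorem of_not {R : α → Baire → Prop} (h : IsSigma1Rel R) : IsSigma2Rel fun a p => ¬ R a p :=
  ⟨fun z => R z.1, h.comp Primrec.fst, fun a p => by simp⟩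

theorem of_isSigma1Rel {R : α → Baire → Prop} (h : IsSigma1Rel R) : IsSigma2Rel R := by
  obtain ⟨P, hP, hPR⟩ := h
  -- for a fixed witness, the negation is checked at one prefix of the right length
  refine ⟨fun z p => ¬ P ((z.1, z.2.unpair.1), initialSegment p z.2.unpair.2) = true,
    ⟨fun y => decide (y.2.length = y.1.1.2.unpair.2) && !P ((y.1.1.1, y.1.1.2.unpair.1), y.2),
      ?_, fun z p => ?_⟩, fun a p => ?_⟩
  · have hz : Primrec fun y : ((α × ℕ) × ℕ) × List ℕ => y.1.1.2.unpair :=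
      Primrec.unpair.comp (Primrec.snd.comp (Primrec.fst.comp Primrec.fst))
    have ha : Primrec fun y : ((α × ℕ) × ℕ) × List ℕ => y.1.1.1 :=
      Primrec.fst.comp (Primrec.fst.comp Primrec.fst)
    have h₁ : PrimrecPred fun y : ((α × ℕ) × ℕ) × List ℕ => y.2.length = y.1.1.2.unpair.2 :=
      Primrec.eq.comp (Primrec.list_length.comp Primrec.snd) (Primrec.snd.comp hz)
    exact Primrec.and.comp h₁.decide
      (Primrec.not.comp (hP.comp ((ha.pair (Primrec.fst.comp hz)).pair Primrec.snd)))
  · simp only [Bool.and_eq_true, decide_eq_true_eq, length_initialSegment]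
    constructor
    · intro h
      exact ⟨0, _, rfl, by simpa using h⟩
    · rintro ⟨-, m, rfl, h⟩
      simpa using h
  · simp only [hPR, not_not]
    exact ⟨fun ⟨n, m, h⟩ => ⟨Nat.pair n m, by simpa using h⟩, fun ⟨n, h⟩ => ⟨_, _, h⟩⟩

theorem comp {R : α → Baire → Prop} (h : IsSigma2Rel R) {f : β → α} (hf : Primrec f) :
    IsSigma2Rel fun b => R (f b) := by
  obtain ⟨P, hP, hPR⟩ := h
  exact ⟨fun z => P (f z.1, z.2), hP.comp ((hf.comp Primrec.fst).pair Primrec.snd),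
    fun b p => hPR _ _⟩

theorem ex {R : α × ℕ → Baire → Prop} (h : IsSigma2Rel R) :
    IsSigma2Rel fun a p => ∃ n, R (a, n) p := by
  obtain ⟨P, hP, hPR⟩ := h
  refine ⟨fun z => P ((z.1, z.2.unpair.1), z.2.unpair.2), hP.comp ?_, fun a p => ?_⟩
  · have hz : Primrec fun z : α × ℕ => z.2.unpair := Primrec.unpair.comp Primrec.snd
    exact (Primrec.fst.pair (Primrec.fst.comp hz)).pair (Primrec.snd.comp hz)
  · simp only [hPR]
    exact ⟨fun ⟨n, k, h⟩ => ⟨Nat.pair n k, by simpa using h⟩, fun ⟨n, h⟩ => ⟨_, _, h⟩⟩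

theorem and {R S : α → Baire → Prop} (hR : IsSigma2Rel R) (hS : IsSigma2Rel S) :
    IsSigma2Rel fun a p => R a p ∧ S a p := by
  obtain ⟨P, hP, hPR⟩ := hR
  obtain ⟨Q, hQ, hQS⟩ := hS
  have hz : Primrec fun z : α × ℕ => z.2.unpair := Primrec.unpair.comp Primrec.snd
  refine ⟨fun z p => P (z.1, z.2.unpair.1) p ∨ Q (z.1, z.2.unpair.2) p,
    (hP.comp (Primrec.fst.pair (Primrec.fst.comp hz))).or
      (hQ.comp (Primrec.fst.pair (Primrec.snd.comp hz))), fun a p => ?_⟩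
  simp only [hPR, hQS, not_or]
  exact ⟨fun ⟨⟨n, h⟩, n', h'⟩ => ⟨Nat.pair n n', by simpa using ⟨h, h'⟩⟩,
    fun ⟨n, h⟩ => ⟨⟨_, h.1⟩, _, h.2⟩⟩

theorem or {R S : α → Baire → Prop} (hR : IsSigma2Rel R) (hS : IsSigma2Rel S) :
    IsSigma2Rel fun a p => R a p ∨ S a p := by
  obtain ⟨P, hP, hPR⟩ := hR
  obtain ⟨Q, hQ, hQS⟩ := hS
  refine ⟨fun z p => P z p ∧ Q z p, hP.and hQ, fun a p => ?_⟩
  simp only [hPR, hQS, not_and_or, exists_or]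

/-- Bounded universal quantifiers: the witnesses are collected in a list. -/
theorem forall_lt {R : α × ℕ → Baire → Prop} (h : IsSigma2Rel R) {f : α → ℕ} (hf : Primrec f) :
    IsSigma2Rel fun a p => ∀ i < f a, R (a, i) p := by
  obtain ⟨P, hP, hPR⟩ := h
  let L : ℕ → List ℕ := fun n => (Encodable.decode (α := List ℕ) n).getD []
  have hL : Primrec L := Primrec.option_getD.comp Primrec.decode (Primrec.const [])
  have h₁ : IsSigma1Rel fun (z : (α × ℕ) × ℕ) (_ : Baire) => z.2 < f z.1.1 :=
    IsSigma1Rel.of_primrecPred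
      (Primrec.nat_lt.comp Primrec.snd (hf.comp (Primrec.fst.comp Primrec.fst)))
  have h₂ : IsSigma1Rel fun z : (α × ℕ) × ℕ => P ((z.1.1, z.2), (L z.1.2).getD z.2 0) :=
    hP.comp (((Primrec.fst.comp Primrec.fst).pair Primrec.snd).pair ((Primrec.list_getD 0).comp
      (hL.comp (Primrec.snd.comp Primrec.fst)) Primrec.snd))
  refine ⟨fun z p => ∃ i, i < f z.1 ∧ P ((z.1, i), (L z.2).getD i 0) p, (h₁.and h₂).ex,
    fun a p => ?_⟩
  · simp only [hPR]
    constructor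
    · intro h
      choose! g hg using h
      refine ⟨Encodable.encode (initialSegment g (f a)), ?_⟩
      rintro ⟨i, hi, h⟩
      simp only [L, Encodable.encodek, Option.getD_some, getD_initialSegment hi] at h
      exact hg i hi h
    · exact fun ⟨n, h⟩ i hi => ⟨_, fun hP => h ⟨i, hi, hP⟩⟩

end IsSigma2Rel

end Relations

theorem REPred.exists_nat {α : Type} [Primcodable α] {P : α × ℕ → Bool} (hP : Primrec P) :
    REPred fun a => ∃ k, P (a, k) = true := by
  have h : Partrec fun a => Nat.rfind fun k => Part.some (P (a, k)) :=
    Partrec.rfind (Computable.partrec hP.to_comp)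
  refine h.dom_re.of_eq fun a => Nat.rfind_dom.trans ?_
  refine exists_congr fun k => ⟨fun h => (Part.mem_some_iff.1 h.1).symm, fun h =>
    ⟨Part.mem_some_iff.2 h.symm, fun _ => trivial⟩⟩

theorem IsSigma2Rel.isSigma02Baire {R : Unit → Baire → Prop} (h : IsSigma2Rel R) :
    IsSigma02Baire {p | R () p} := by
  obtain ⟨R', ⟨P, hP, hPR⟩, h⟩ := h
  refine ⟨fun n u => ∃ k, P ((((), n), k), u) = true,
    REPred.exists_nat (P := fun z : (ℕ × List ℕ) × ℕ => P ((((), z.1.1), z.2), z.1.2)) ?_,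
    fun p => ?_⟩
  · have h₁ : Primrec fun z : (ℕ × List ℕ) × ℕ => z.1 := Primrec.fst
    exact hP.comp ((((Primrec.const ()).pair (Primrec.fst.comp h₁)).pair Primrec.snd).pair
      (Primrec.snd.comp h₁))
  · simp only [Set.mem_ofPred, h, hPR]
    refine exists_congr fun n => ⟨?_, ?_⟩
    · rintro h u hu ⟨k, hk⟩
      exact h ⟨k, u.length, by rwa [show initialSegment p u.length = u from hu]⟩
    · rintro h ⟨k, m, hk⟩
      exact h _ (isPrefixOf_initialSegment p m) ⟨k, hk⟩

/-! ### A name of the second half of an open set -/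

theorem isPrefixOf_cons_intoHalf_one {h : ℕ} {t : List ℕ} {q : Baire} :
    IsPrefixOf (h :: t) (intoHalf 1 q) ↔ h % 2 = 1 ∧ IsPrefixOf (h / 2 :: t) q := by
  have cons : ∀ (h : ℕ) (q : Baire), IsPrefixOf (h :: t) q ↔
      q 0 = h ∧ ∀ j < t.length, q (j + 1) = t.getD j 0 := by
    intro h q
    rw [isPrefixOf_iff]
    refine ⟨fun H => ⟨H 0 (by simp), fun j hj => by simpa using H (j + 1) (by simpa using hj)⟩, ?_⟩
    rintro ⟨h₀, H⟩ j hj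
    cases j with
    | zero => simpa using h₀
    | succ j => simpa using H j (by simpa using hj)
  rw [cons, cons, intoHalf_zero, ← and_assoc]
  refine and_congr (by omega) (forall₂_congr fun j _ => ?_)
  simp [intoHalf]

/-- Turns pairs describing a realizer `F` into pairs describing `F ∘ intoHalf 1`. Pairs `(u, v)` with
`u` a prefix of sequences in the other half only are replaced by a trivial pair. -/
def shiftPair (z : List ℕ × List ℕ) : List ℕ × List ℕ :=
  if z.1.length = 0 then z
  else if z.1.headI % 2 = 1 then (z.1.headI / 2 :: z.1.tail, z.2) else ([], [])

theorem isName_half_one {p : Baire} {O : OpenSubsets Baire} (hp : IsName p O) :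
    IsName (fun i => Encodable.encode (shiftPair (pairOf (p i)))) (half 1 O) := by
  obtain ⟨F, hF, hFO⟩ := isName_iff_describes.1 hp
  refine isName_iff_describes.2 ⟨fun q => F (intoHalf 1 q), fun q => ⟨fun u v huv hu => ?_,
    fun v hv => ?_⟩, fun q => hFO (intoHalf 1 q)⟩
  · obtain ⟨i, hi⟩ := listsPair_iff.1 huv
    rw [pairOf_encode] at hi
    have hl := (hF (intoHalf 1 q)).1 _ _ (listsPair_pairOf p i)
    rcases hz : pairOf (p i) with ⟨_ | ⟨h, t⟩, w⟩
    · simp only [hz, shiftPair, List.length_nil, if_true, Prod.mk.injEq] at hi hl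
      rw [← hi.2]
      exact hl rfl
    · simp only [hz, shiftPair, List.length_cons, Nat.succ_ne_zero, if_false, List.headI_cons,
        List.tail_cons] at hi hl
      split_ifs at hi with h₁
      · obtain ⟨rfl, rfl⟩ := Prod.mk.inj hi
        exact hl (isPrefixOf_cons_intoHalf_one.2 ⟨h₁, hu⟩)
      · obtain ⟨rfl, rfl⟩ := Prod.mk.inj hi
        rfl
  · obtain ⟨u, hu, huv⟩ := (hF (intoHalf 1 q)).2 v hv
    obtain ⟨i, hi⟩ := listsPair_iff.1 huv
    have hl := listsPair_pairOf (fun i => Encodable.encode (shiftPair (pairOf (p i)))) i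
    simp only [hi, pairOf_encode] at hl
    rcases u with _ | ⟨h, t⟩
    · exact ⟨[], rfl, by simpa [shiftPair] using hl⟩
    · obtain ⟨h₁, h₂⟩ := isPrefixOf_cons_intoHalf_one.1 hu
      exact ⟨_, h₂, by simpa [shiftPair, h₁] using hl⟩

theorem primrec_pairOf : Primrec pairOf := by
  have h : Primrec fun c : ℕ => (Encodable.decode (α := List ℕ × List ℕ) c).getD ([], []) :=
    Primrec.option_getD.comp Primrec.decode (Primrec.const _)
  refine h.of_eq fun c => ?_
  conv_lhs => rw [← encode_pairOf c, Encodable.encodek]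
  rfl

theorem primrec_shiftPair : Primrec shiftPair := by
  have h₁ : Primrec fun z : List ℕ × List ℕ => z.1.headI := Primrec.list_headI.comp Primrec.fst
  refine Primrec.ite (Primrec.eq.comp (Primrec.list_length.comp Primrec.fst) (Primrec.const 0))
    Primrec.id (Primrec.ite (Primrec.eq.comp (Primrec.nat_mod.comp h₁ (Primrec.const 2))
      (Primrec.const 1)) (Primrec.pair ?_ Primrec.snd) (Primrec.const _))
  exact Primrec.list_cons.comp (Primrec.nat_div.comp h₁ (Primrec.const 2))
    (Primrec.list_tail.comp Primrec.fst)

/-! ### The graph of the decoding map is effectively `Σ⁰₂` -/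

/-- The images under `intoHalf 0` of the constant sequence `n` (for `k = 0`) and of `c_{n,k}`
(for `k ≥ 1`). -/
def probe (n k : ℕ) : Baire := fun j => if j = 0 then 2 * n else if j = k then n + 1 else n

theorem probe_zero (n : ℕ) : probe n 0 = intoHalf 0 fun _ => n := by
  funext j
  rcases eq_or_ne j 0 with rfl | hj
  · simp [probe, intoHalf]
  · simp [probe, intoHalf, hj]

theorem probe_of_pos (n : ℕ) {k : ℕ} (hk : 1 ≤ k) : probe n k = intoHalf 0 (bumpSeq n k) := by
  funext j
  rcases eq_or_ne j 0 with rfl | hj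
  · simp [probe, intoHalf, bumpSeq_of_ne (by omega : 0 ≠ k)]
  · rcases eq_or_ne j k with rfl | hjk
    · simp [probe, intoHalf, hj, bumpSeq_self]
    · simp [probe, intoHalf, hj, hjk, bumpSeq_of_ne hjk]

/-- The name `p ∘ σ` announces that `probe n k` belongs to an open set, by means of a prefix of
length at most `N`. -/
def ProbeWithin (σ : ℕ → ℕ) (a : (ℕ × ℕ) × ℕ) (p : Baire) : Prop :=
  ∃ i, ∃ l, (pairOf (p (σ i))).2.getD l 0 ≠ 0 ∧
    initialSegment (probe a.1.1 a.1.2) (pairOf (p (σ i))).1.length = (pairOf (p (σ i))).1 ∧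
    (pairOf (p (σ i))).1.length ≤ a.2

theorem isSigma1Rel_probeWithin {σ : ℕ → ℕ} (hσ : Primrec σ) : IsSigma1Rel (ProbeWithin σ) := by
  have ha : Primrec fun y : ((((ℕ × ℕ) × ℕ) × ℕ) × ℕ) × ℕ => y.1.1.1 :=
    Primrec.fst.comp (Primrec.fst.comp Primrec.fst)
  have hn : Primrec fun y : ((((ℕ × ℕ) × ℕ) × ℕ) × ℕ) × ℕ => y.1.1.1.1.1 :=
    Primrec.fst.comp (Primrec.fst.comp ha)
  have hk : Primrec fun y : ((((ℕ × ℕ) × ℕ) × ℕ) × ℕ) × ℕ => y.1.1.1.1.2 :=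
    Primrec.snd.comp (Primrec.fst.comp ha)
  have hz : Primrec fun y : ((((ℕ × ℕ) × ℕ) × ℕ) × ℕ) × ℕ => pairOf y.2 :=
    primrec_pairOf.comp Primrec.snd
  have hlen : Primrec fun y : ((((ℕ × ℕ) × ℕ) × ℕ) × ℕ) × ℕ => (pairOf y.2).1.length :=
    Primrec.list_length.comp (Primrec.fst.comp hz)
  have hprobe : Primrec₂ fun (y : ((((ℕ × ℕ) × ℕ) × ℕ) × ℕ) × ℕ) (j : ℕ) =>
      probe y.1.1.1.1.1 y.1.1.1.1.2 j := by
    have hn' := hn.comp (Primrec.fst (β := ℕ))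
    exact Primrec.ite (Primrec.eq.comp Primrec.snd (Primrec.const 0))
      (Primrec.nat_mul.comp (Primrec.const 2) hn')
      (Primrec.ite (Primrec.eq.comp Primrec.snd (hk.comp Primrec.fst)) (Primrec.succ.comp hn') hn')
  have h₁ : PrimrecPred fun y : ((((ℕ × ℕ) × ℕ) × ℕ) × ℕ) × ℕ => ¬ (pairOf y.2).2.getD y.1.2 0 = 0 :=
    PrimrecPred.not (Primrec.eq.comp ((Primrec.list_getD 0).comp (Primrec.snd.comp hz)
      (Primrec.snd.comp Primrec.fst)) (Primrec.const 0))
  have h₂ : PrimrecPred fun y : ((((ℕ × ℕ) × ℕ) × ℕ) × ℕ) × ℕ =>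
      initialSegment (probe y.1.1.1.1.1 y.1.1.1.1.2) (pairOf y.2).1.length = (pairOf y.2).1 :=
    Primrec.eq.comp (Primrec.list_map (Primrec.list_range.comp hlen) hprobe) (Primrec.fst.comp hz)
  have h₃ : PrimrecPred fun y : ((((ℕ × ℕ) × ℕ) × ℕ) × ℕ) × ℕ =>
      (pairOf y.2).1.length ≤ y.1.1.1.2 := Primrec.nat_le.comp hlen (Primrec.snd.comp ha)
  have h : IsSigma1Rel fun (y : (((ℕ × ℕ) × ℕ) × ℕ) × ℕ) (p : Baire) => _ :=
    IsSigma1Rel.eval (h₁.and (h₂.and h₃)).decide.to₂ (hσ.comp (Primrec.snd.comp Primrec.fst))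
  exact h.ex.ex.of_iff fun a p => by simp [ProbeWithin]

/-- The name `p ∘ σ` announces that `probe n k` belongs to an open set. -/
def ProbeIn (σ : ℕ → ℕ) (a : ℕ × ℕ) (p : Baire) : Prop := ∃ N, ProbeWithin σ (a, N) p

theorem probeIn_iff {σ : ℕ → ℕ} {p : Baire} {O : OpenSubsets Baire}
    (hp : IsName (fun i => p (σ i)) O) {n k : ℕ} : ProbeIn σ (n, k) p ↔ probe n k ∈ O := by
  rw [mem_iff_of_isName hp (rfl : IsName (probe n k) (probe n k))]
  exact ⟨fun ⟨_, i, l, h, h', _⟩ => ⟨i, ⟨l, h⟩, h'⟩, fun ⟨i, ⟨l, h⟩, h'⟩ => ⟨_, i, l, h, h', le_rfl⟩⟩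

/-- The relation `f n = a` for the decoding `f` of the first half of the open set with name `p ∘ σ`:
a prefix witnessing that the constant sequence `n` belongs to the open set takes care of almost all
`c_{n,k}`, so that only finitely many `k > a` are left to be checked. -/
def DecodesTo (σ : ℕ → ℕ) (a : ℕ × ℕ) (p : Baire) : Prop :=
  (a.2 = 0 ∧ ¬ ProbeIn σ (a.1, 0) p) ∨
    ((∃ N, ProbeWithin σ ((a.1, 0), N) p ∧ ∀ k < N, k ≤ a.2 ∨ ProbeIn σ (a.1, k) p) ∧
      (a.2 = 0 ∨ ¬ ProbeIn σ a p))

theorem isSigma2Rel_decodesTo {σ : ℕ → ℕ} (hσ : Primrec σ) : IsSigma2Rel (DecodesTo σ) := by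
  have hw := isSigma1Rel_probeWithin hσ
  have hin : IsSigma1Rel (ProbeIn σ) := hw.ex
  have h0 : IsSigma2Rel fun (a : ℕ × ℕ) (_ : Baire) => a.2 = 0 := .of_isSigma1Rel
    (.of_primrecPred (Primrec.eq.comp Primrec.snd (Primrec.const 0)))
  have hle : IsSigma2Rel fun (z : ((ℕ × ℕ) × ℕ) × ℕ) (_ : Baire) => z.2 ≤ z.1.1.2 :=
    .of_isSigma1Rel (.of_primrecPred (Primrec.nat_le.comp Primrec.snd
      (Primrec.snd.comp (Primrec.fst.comp Primrec.fst))))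
  have hn : IsSigma2Rel fun a : ℕ × ℕ => fun p => ¬ ProbeIn σ (a.1, 0) p :=
    .of_not (hin.comp (Primrec.fst.pair (Primrec.const 0)))
  have hN : IsSigma2Rel fun z : (ℕ × ℕ) × ℕ => ProbeWithin σ ((z.1.1, 0), z.2) :=
    .of_isSigma1Rel (hw.comp
      (((Primrec.fst.comp Primrec.fst).pair (Primrec.const 0)).pair Primrec.snd))
  have hk : IsSigma2Rel fun z : ((ℕ × ℕ) × ℕ) × ℕ => ProbeIn σ (z.1.1.1, z.2) :=
    .of_isSigma1Rel (hin.comp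
      ((Primrec.fst.comp (Primrec.fst.comp Primrec.fst)).pair Primrec.snd))
  exact (h0.and hn).or
    ((hN.and ((hle.or hk).forall_lt Primrec.snd)).ex.and (h0.or (.of_not hin)))

theorem decodesTo_iff {σ : ℕ → ℕ} {p : Baire} {O : OpenSubsets Baire}
    (hp : IsName (fun i => p (σ i)) O) {n a : ℕ} :
    DecodesTo σ (n, a) p ↔ decodeSeq (half 0 O) n = a := by
  have hc : ProbeIn σ (n, 0) p ↔ (fun _ => n : Baire) ∈ half 0 O := by
    rw [probeIn_iff hp, probe_zero, mem_half]
  have hb : ∀ {k}, 1 ≤ k → (ProbeIn σ (n, k) p ↔ bumpSeq n k ∈ half 0 O) := fun hk => by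
    rw [probeIn_iff hp, probe_of_pos n hk, mem_half]
  have ha : (a = 0 ∨ ¬ ProbeIn σ (n, a) p) ↔ (a = 0 ∨ bumpSeq n a ∉ half 0 O) := by
    rcases Nat.eq_zero_or_pos a with rfl | h
    · simp
    · rw [hb h]
  simp only [DecodesTo]
  by_cases h : (fun _ => n : Baire) ∈ half 0 O
  · rw [decodeSeq_eq_iff h, ha, or_iff_right fun h' => h'.2 (hc.2 h)]
    refine and_congr_left fun _ => ⟨?_, fun H => ?_⟩
    · rintro ⟨N, ⟨i, l, hv, hu, hl⟩, H⟩ k hk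
      rw [← hb (by omega)]
      rcases lt_or_ge k N with hkN | hkN
      · exact (H k hkN).resolve_left (by omega)
      -- `probe n k` and `probe n 0` agree below `k`
      · refine ⟨N, i, l, hv, IsPrefixOf.congr hu fun j hj => ?_, hl⟩
        have hjk : j ≠ k := (hj.trans_le (hl.trans hkN)).ne
        by_cases hj0 : j = 0 <;> simp [probe, hjk, hj0]
    · obtain ⟨N, hN⟩ := hc.2 h
      refine ⟨N, hN, fun k _ => or_iff_not_imp_left.2 fun hk => ?_⟩
      exact (hb (by omega)).2 (H k (by omega))
  · have hN : ¬ ∃ N, ProbeWithin σ ((n, 0), N) p ∧ ∀ k < N, k ≤ a ∨ ProbeIn σ (n, k) p :=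
      fun ⟨N, hN, _⟩ => h (hc.1 ⟨N, hN⟩)
    rw [decodeSeq_of_notMem h]
    simp only [hN, false_and, or_false, hc, h, not_false_eq_true, and_true]
    exact eq_comm

/-! ### `Σ⁰₂`-measurability of the retraction -/

theorem isSigma2Rel_exists_pair {g : ℕ → List ℕ × List ℕ} {τ : ℕ → ℕ} (hg : Primrec g)
    (hτ : Primrec τ) {R : ℕ × ℕ → Baire → Prop} (hR : IsSigma2Rel R) :
    IsSigma2Rel fun (_ : Unit) p => ∃ i, Hits (g (p (τ i))).2 ∧
      ∀ j < (g (p (τ i))).1.length, R (p (τ i), j) p := by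
  have hc : Primrec fun z : ((Unit × ℕ) × ℕ) × ℕ => z.1.1.2 :=
    Primrec.snd.comp (Primrec.fst.comp Primrec.fst)
  have h₁ : IsSigma2Rel fun (z : ((Unit × ℕ) × ℕ) × ℕ) p => decide (p (τ z.1.2) = z.1.1.2) = true :=
    .of_isSigma1Rel (.eval (Q := fun (z : ((Unit × ℕ) × ℕ) × ℕ) x => decide (x = z.1.1.2))
      (PrimrecPred.decide (Primrec.eq.comp Primrec.snd (hc.comp Primrec.fst)))
      (hτ.comp (Primrec.snd.comp Primrec.fst)))
  have h₂ : IsSigma2Rel fun (z : ((Unit × ℕ) × ℕ) × ℕ) (_ : Baire) =>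
      ¬ (g z.1.1.2).2.getD z.2 0 = 0 :=
    .of_not (.of_primrecPred (Primrec.eq.comp ((Primrec.list_getD 0).comp
      (Primrec.snd.comp (hg.comp hc)) Primrec.snd) (Primrec.const 0)))
  have h₃ : IsSigma2Rel fun (z : ((Unit × ℕ) × ℕ) × ℕ) (p : Baire) =>
      ∀ j < (g z.1.1.2).1.length, R (z.1.1.2, j) p :=
    .forall_lt (R := fun y : (((Unit × ℕ) × ℕ) × ℕ) × ℕ => R (y.1.1.1.2, y.2))
      (hR.comp ((hc.comp Primrec.fst).pair Primrec.snd))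
      (Primrec.list_length.comp (Primrec.fst.comp (hg.comp hc)))
  refine (h₁.and (h₂.and h₃)).ex.ex.ex.of_iff fun _ p => ?_
  constructor
  · rintro ⟨i, ⟨l, hl⟩, h⟩
    exact ⟨p (τ i), i, l, by simp, hl, h⟩
  · rintro ⟨c, i, l, hc, hl, h⟩
    obtain rfl : p (τ i) = c := by simpa using hc
    exact ⟨i, ⟨l, hl⟩, h⟩

theorem isSigma02_preimage_retraction : IsSigma02 (retraction ⁻¹' membershipSet) := by
  have hg : Primrec fun c => shiftPair (pairOf c) := primrec_shiftPair.comp primrec_pairOf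
  have hR : IsSigma2Rel fun z : ℕ × ℕ => DecodesTo id (z.2, (shiftPair (pairOf z.1)).1.getD z.2 0) :=
    (isSigma2Rel_decodesTo Primrec.id).comp (Primrec.snd.pair ((Primrec.list_getD 0).comp
      (Primrec.fst.comp (hg.comp Primrec.fst)) Primrec.snd))
  refine ⟨_, (isSigma2Rel_exists_pair hg Primrec.id hR).isSigma02Baire, fun p O hp => ?_⟩
  change decodeSeq (half 0 O) ∈ half 1 O ↔ _
  rw [mem_iff_of_isName (isName_half_one hp) (rfl : IsName (decodeSeq (half 0 O)) _)]
  refine exists_congr fun i => ?_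
  simp only [pairOf_encode, isPrefixOf_iff, id, decodesTo_iff (σ := id) hp]

theorem isSigma02Measurable_retraction : IsSigma02Measurable retraction := by
  have hdbl : Primrec fun i => 2 * i := Primrec.nat_mul.comp (Primrec.const 2) Primrec.id
  have hu : Primrec fun z : ℕ × ℕ => (pairOf z.1).1.getD z.2 0 := (Primrec.list_getD 0).comp
    (Primrec.fst.comp (primrec_pairOf.comp Primrec.fst)) Primrec.snd
  have hdiv : Primrec fun z : ℕ × ℕ => z.2 / 2 := Primrec.nat_div.comp Primrec.snd (Primrec.const 2)
  have hmod : ∀ b, PrimrecPred fun z : ℕ × ℕ => z.2 % 2 = b := fun b =>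
    Primrec.eq.comp (Primrec.nat_mod.comp Primrec.snd (Primrec.const 2)) (Primrec.const b)
  have h₁ : IsSigma2Rel fun z : ℕ × ℕ =>
      DecodesTo (fun i => 2 * i) (z.2 / 2, (pairOf z.1).1.getD z.2 0) :=
    (isSigma2Rel_decodesTo hdbl).comp (hdiv.pair hu)
  have h₂ : IsSigma2Rel fun (z : ℕ × ℕ) p => decide (Encodable.encode
      (shiftPair (pairOf (p (2 * (z.2 / 2))))) = (pairOf z.1).1.getD z.2 0) = true :=
    .of_isSigma1Rel (.eval (Q := fun (z : ℕ × ℕ) x => decide (Encodable.encode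
      (shiftPair (pairOf x)) = (pairOf z.1).1.getD z.2 0))
      (PrimrecPred.decide (Primrec.eq.comp (Primrec.encode.comp (primrec_shiftPair.comp
        (primrec_pairOf.comp Primrec.snd))) (hu.comp Primrec.fst))) (hdbl.comp hdiv))
  have hR := ((IsSigma2Rel.of_isSigma1Rel (.of_primrecPred (hmod 1))).or h₁).and
    ((IsSigma2Rel.of_isSigma1Rel (.of_primrecPred (hmod 0))).or h₂)
  refine ⟨_, (isSigma2Rel_exists_pair primrec_pairOf (Primrec.succ.comp hdbl) hR).isSigma02Baire, ?_⟩
  rintro p ⟨O, U⟩ ⟨hO, hU⟩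
  -- the name of `retraction O` that is computed from `p`
  let q : Baire := fun m => if m % 2 = 0 then decodeSeq (half 0 O) (m / 2)
    else Encodable.encode (shiftPair (pairOf (p (2 * (m / 2)))))
  have hq : IsName q (retraction O) := by
    constructor
    · change (fun n => q (2 * n)) = decodeSeq (half 0 O)
      funext n
      simp [q]
    · have h : (fun n => q (2 * n + 1)) =
          fun n => Encodable.encode (shiftPair (pairOf (p (2 * n)))) := by
        funext n
        have h1 : (2 * n + 1) / 2 = n := by omega
        simp [q, h1]
      change IsName (fun n => q (2 * n + 1)) (half 1 O)
      rw [h]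
      exact isName_half_one hO
  change retraction O ∈ U ↔ _
  rw [mem_iff_of_isName hU hq]
  refine exists_congr fun i => and_congr_right fun _ => ?_
  rw [isPrefixOf_iff]
  refine forall₂_congr fun j _ => ?_
  simp only [decodesTo_iff (σ := fun i => 2 * i) hO, decide_eq_true_eq, q]
  rcases Nat.mod_two_eq_zero_or_one j with hj | hj <;> simp [hj]

theorem mainTheorem1 :
    -- the canonical topology of `O(𝒩)` is the Scott topology
    repTopology (OpenSubsets Baire) = Topology.scott (OpenSubsets Baire) Set.univ ∧
    -- `r` is a `Σ⁰₂`-measurable retraction of `O(𝒩)` onto `𝒩 × O(𝒩)`, with a section that is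
    -- continuous for the product topology
    IsSigma02Measurable retraction ∧
    (∃ s : Baire × OpenSubsets Baire → OpenSubsets Baire,
      (@Continuous (Baire × OpenSubsets Baire) (OpenSubsets Baire)
        (@instTopologicalSpaceProd Baire (OpenSubsets Baire)
          (repTopology Baire) (repTopology (OpenSubsets Baire)))
        (repTopology (OpenSubsets Baire)) s) ∧
      ∀ z, retraction (s z) = z) ∧
    -- `r⁻¹(E)` is a `Σ⁰₂` subset of `O(𝒩)` that is not Borel
    ∃ A : Set (OpenSubsets Baire),
      A = retraction ⁻¹' membershipSet ∧ IsSigma02 A ∧ ¬ IsBorelSubset A :=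
  ⟨repTopology_openSubsets_baire, isSigma02Measurable_retraction,
    ⟨retractionSection, continuous_retractionSection, retraction_retractionSection⟩,
    _, rfl, isSigma02_preimage_retraction, not_isBorelSubset_preimage_retraction⟩
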